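/- All graphs are finite and simple. A graph $H$ is immersed in a graph $G$ if there are an injective map $\varphi:V(H)\to V(G)$ and, for every edge $uv\in E(H)$, a path $P_{uv}$ in $G$ joining $\varphi(u)$ and $\varphi(v)$, such that the paths $P_{uv}$ ($uv\in E(H)$) are pairwise edge-disjoint. Call a graph $G$ a counterexample if its independence number satisfies $\alpha(G)\le 2$ but the complete graph $K_{\chi(G)}$ is not immersed in $G$, where $\chi(G)$ is the chromatic number. Theorem. Let $G$ be a counterexample with the minimum number $n$ of vertices among all counterexamples. Then: 1. $G$ has the minimum chromatic number among all counterexamples. 2. For every $v\in V(G)$, the graph $\overline{G}-v$ has a perfect matching, where $\overline{G}$ is the complement of $G$. 3. Any two distinct non-adjacent vertices $x,y$ of $G$ satisfy $|N(x)\cap N(y)|\le \frac{n-1}{2}$. 4. The clique number satisfies $\omega(G)\ge \frac{n+1}{4}$. 5. $G$ is connected. 6. The minimum degree satisfies $\delta(G)\ge \lceil \frac n2\rceil$. 7. $G$ has a Hamiltonian cycle. 8. For every $v\in V(G)$, the graph $G-v$ has a perfect matching. 9. Any two vertices $x,y\in V(G)$ are at distance $d(x,y)\le 2$. 10. $\chi(G)\ge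 8$. If moreover $G$ has the minimum number of edges among all counterexamples with the minimum number of vertices, then 11. $\alpha(G-e)>\alpha(G)$ for every edge $e\in E(G)$. -/

import Mathlib

open SimpleGraph

universe u

/-- `H` is immersed in `G`: there are an injection `φ : V(H) → V(G)` and, for every edge `uv` of
`H`, a path of `G` joining `φ u` and `φ v`, such that the paths of distinct edges of `H` are
edge-disjoint.  The paths are indexed by the two orientations of each edge; no condition relates
`P u v` and `P v u`, so keeping one orientation of each edge gives one path for every edge. -/
def Immersed {W V : Type*} (H : SimpleGraph W) (G : SimpleGraph V) : Prop :=
  ∃ (φ : W ↪ V) (P : ∀ u v : W, H.Adj u v → G.Walk (φ u) (φ v)),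
    (∀ (u v : W) (h : H.Adj u v), (P u v h).IsPath) ∧
    ∀ (u v u' v' : W) (h : H.Adj u v) (h' : H.Adj u' v'), s(u, v) ≠ s(u', v') →
      List.Disjoint (P u v h).edges (P u' v' h').edges

/-- `G` is a counterexample to the assertion "if `α(G) ≤ 2`, then `K_{χ(G)}` is immersed
in `G`". -/
def IsCounterexample {V : Type*} [Finite V] (G : SimpleGraph V) : Prop :=
  G.indepNum ≤ 2 ∧
    ∃ t : ℕ, G.chromaticNumber = t ∧ ¬ Immersed (completeGraph (Fin t)) G

/-- `G` is a counterexample with the minimum number of vertices among all counterexamples. -/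
def IsVertexMinCounterexample {V : Type u} [Finite V] (G : SimpleGraph V) : Prop :=
  IsCounterexample G ∧
    ∀ (W : Type u) [Finite W] (H : SimpleGraph W), IsCounterexample H → Nat.card V ≤ Nat.card W

/-- `G` is a counterexample with the minimum chromatic number among all counterexamples. -/
def IsChromaticMinCounterexample {V : Type u} [Finite V] (G : SimpleGraph V) : Prop :=
  IsCounterexample G ∧
    ∀ (W : Type u) [Finite W] (H : SimpleGraph W), IsCounterexample H →
      G.chromaticNumber ≤ H.chromaticNumber

/-- `G` has the minimum number of edges among all counterexamples with the minimum number of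
vertices. -/
def IsEdgeMinCounterexample {V : Type u} [Finite V] (G : SimpleGraph V) : Prop :=
  IsVertexMinCounterexample G ∧
    ∀ (W : Type u) [Finite W] (H : SimpleGraph W), IsVertexMinCounterexample H →
      G.edgeSet.ncard ≤ H.edgeSet.ncard

/-- `G` has a perfect matching. -/
def HasPerfectMatching {V : Type*} (G : SimpleGraph V) : Prop :=
  ∃ M : G.Subgraph, M.IsPerfectMatching

/-- The graph `G - v`. -/
abbrev deleteVertex {V : Type*} (G : SimpleGraph V) (v : V) : SimpleGraph {w : V | w ≠ v} :=
  G.induce {w : V | w ≠ v}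

/-! When `α ≤ 2`, colour classes have at most two vertices, so an optimal colouring is a maximum
matching of the complement, with `2χ = n + (unmatched vertices)`. In a minimum counterexample every
proper induced subgraph has its clique immersion. Hence the complement is connected (immersions in
the two sides of a join add up), and deleting any vertex lowers `χ`, so every vertex is missed by a
maximum matching. Gallai's lemma makes the complement factor-critical, and `n = 2t - 1` with `t =
χ(G)`. Likewise any counterexample contains an induced one with `2χ - 1` vertices and no larger `χ`;
this compares chromatic numbers.

Two estimates carry the rest. All degrees exceed `t`: the matching `f` of the complement missing `v`
joins non-adjacent neighbours `a`, `b` of `v` by the chain `a, f b, f a, b`, so a small degree would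
make `v` and its neighbours the branch vertices of an immersed `K_t`. Non-adjacent `x`, `y` have at
most `t - 3` common neighbours: `G - x - y` has an immersed `K_{t-1}`, and enough common neighbours
`c` outside it would provide paths `x, c, y, b` to the branch vertices `b` not adjacent to `x`.

Since `d(x) + d(y) + 2 = n + |N(x) ∩ N(y)|`, these combine to `2t + 2 ≤ 3t - 6`, so `t ≥ 8`; they
also give the distance bound, connectedness and a large clique of non-neighbours. Dirac's theorem
gives the Hamiltonian cycle and, by the same cyclic arrangement, the matchings of `G - v`. -/

/-! ### Immersions as edge labellings -/

/-- The edges of `G` that carry the label `p` in both directions. -/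
def labelGraph {V : Type*} (G : SimpleGraph V) (l : V → V → Sym2 V) (p : Sym2 V) :
    SimpleGraph V where
  Adj a b := G.Adj a b ∧ l a b = p ∧ l b a = p
  symm := ⟨fun _ _ h => ⟨h.1.symm, h.2.2, h.2.1⟩⟩
  loopless := ⟨fun _ h => h.1.ne rfl⟩

/-- Any two vertices `u`, `v` of `B` are joined by edges of `G` labelled by the pair `uv`. -/
def IsLabelledClique {V : Type*} (G : SimpleGraph V) (B : Finset V) (l : V → V → Sym2 V) : Prop :=
  ∀ u ∈ B, ∀ v ∈ B, u ≠ v → (labelGraph G l s(u, v)).Reachable u v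

/-- A complete graph on `k` vertices is immersed in `G`, expressed by a labelling of the edges. -/
def HasCliqueImmersion {V : Type*} (G : SimpleGraph V) (k : ℕ) : Prop :=
  ∃ B : Finset V, B.card = k ∧ ∃ l : V → V → Sym2 V, IsLabelledClique G B l

theorem labelGraph_le {V : Type*} (G : SimpleGraph V) (l : V → V → Sym2 V) (p : Sym2 V) :
    labelGraph G l p ≤ G := fun _ _ h => h.1

theorem labelGraph_mono {V : Type*} {G H : SimpleGraph V} (hGH : G ≤ H) (l : V → V → Sym2 V)
    (p : Sym2 V) : labelGraph G l p ≤ labelGraph H l p := fun _ _ h => ⟨hGH h.1, h.2⟩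

/-- Edge-disjointness makes the pair whose path uses a given edge unique, so an arbitrary choice of
such a pair is the right label. -/
theorem HasCliqueImmersion.of_immersed {V : Type*} {G : SimpleGraph V} {t : ℕ}
    (h : Immersed (completeGraph (Fin t)) G) : HasCliqueImmersion G t := by
  classical
  obtain ⟨φ, P, -, hd⟩ := h
  let Q : V → V → Fin t × Fin t → Prop := fun a b ij =>
    ∃ h : (completeGraph (Fin t)).Adj ij.1 ij.2, s(a, b) ∈ (P ij.1 ij.2 h).edges
  let l : V → V → Sym2 V := fun a b =>
    if h : ∃ ij, Q a b ij then s(φ h.choose.1, φ h.choose.2) else s(a, b)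
  have key : ∀ i j (h : (completeGraph (Fin t)).Adj i j) a b, s(a, b) ∈ (P i j h).edges →
      l a b = s(φ i, φ j) := by
    intro i j h a b hab
    have hex : ∃ ij, Q a b ij := ⟨(i, j), h, hab⟩
    obtain ⟨h', hab'⟩ := hex.choose_spec
    have hl : l a b = s(φ hex.choose.1, φ hex.choose.2) := dif_pos hex
    rw [hl]
    by_contra hne
    refine hd _ _ _ _ h' h (fun he => hne ?_) hab' hab
    exact congrArg (Sym2.map φ) he
  refine ⟨Finset.univ.map φ, by simp, l, ?_⟩
  intro u hu v hv huv
  simp only [Finset.mem_map, Finset.mem_univ, true_and] at hu hv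
  obtain ⟨i, rfl⟩ := hu
  obtain ⟨j, rfl⟩ := hv
  have hij : (completeGraph (Fin t)).Adj i j := fun h => huv (by rw [h])
  refine ⟨(P i j hij).transfer _ ?_⟩
  intro e he
  induction e with
  | _ a b =>
    have hadj := (P i j hij).adj_of_mem_edges he
    exact ⟨hadj, key i j hij a b he, key i j hij b a (by rwa [Sym2.eq_swap])⟩

/-- Label graphs of different pairs share no edge, so paths chosen inside them are automatically
edge-disjoint. -/
theorem HasCliqueImmersion.immersed {V : Type*} {G : SimpleGraph V} {t : ℕ}
    (h : HasCliqueImmersion G t) : Immersed (completeGraph (Fin t)) G := by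
  classical
  obtain ⟨B, rfl, l, hl⟩ := h
  let e := B.equivFin.symm
  let φ : Fin B.card ↪ V := e.toEmbedding.trans (Function.Embedding.subtype _)
  have hr : ∀ i j, (completeGraph (Fin B.card)).Adj i j →
      ∃ w : (labelGraph G l s(φ i, φ j)).Walk (φ i) (φ j), w.IsPath := by
    intro i j hij
    obtain ⟨w⟩ := hl (φ i) (e i).2 (φ j) (e j).2 (fun h => hij (φ.injective h))
    exact ⟨w.bypass, w.bypass_isPath⟩
  choose w hw using hr
  refine ⟨φ, fun i j h => (w i j h).mapLe (labelGraph_le _ _ _), ?_, ?_⟩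
  · intro i j h
    exact (Walk.isPath_mapLe _).2 (hw i j h)
  · intro i j i' j' h h' hne
    rw [List.disjoint_left]
    intro e he he'
    rw [Walk.edges_mapLe_eq_edges] at he he'
    induction e with
    | _ a b =>
      have h1 := ((w i j h).adj_of_mem_edges he).2.1
      have h2 := ((w i' j' h').adj_of_mem_edges he').2.1
      exact hne (Sym2.map.injective φ.injective (h1.symm.trans h2))

theorem immersed_completeGraph_iff {V : Type*} {G : SimpleGraph V} {t : ℕ} :
    Immersed (completeGraph (Fin t)) G ↔ HasCliqueImmersion G t :=
  ⟨HasCliqueImmersion.of_immersed, HasCliqueImmersion.immersed⟩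

theorem HasCliqueImmersion.le {V : Type*} {G : SimpleGraph V} {t k : ℕ}
    (h : HasCliqueImmersion G t) (hk : k ≤ t) : HasCliqueImmersion G k := by
  obtain ⟨B, rfl, l, hl⟩ := h
  obtain ⟨B', hB', rfl⟩ := Finset.exists_subset_card_eq hk
  exact ⟨B', rfl, l, fun u hu v hv => hl u (hB' hu) v (hB' hv)⟩

theorem IsLabelledClique.mono {V : Type*} {G H : SimpleGraph V} (hGH : G ≤ H) {B : Finset V}
    {l : V → V → Sym2 V} (h : IsLabelledClique G B l) : IsLabelledClique H B l :=
  fun u hu v hv huv => (h u hu v hv huv).mono (labelGraph_mono hGH l _)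

theorem HasCliqueImmersion.mono {V : Type*} {G H : SimpleGraph V} (hGH : G ≤ H) {t : ℕ}
    (h : HasCliqueImmersion G t) : HasCliqueImmersion H t := by
  obtain ⟨B, hB, l, hl⟩ := h
  exact ⟨B, hB, l, hl.mono hGH⟩

theorem IsLabelledClique.exists_map {W V : Type*} (φ : W ↪ V) {H : SimpleGraph W} {B : Finset W}
    {l : W → W → Sym2 W} (h : IsLabelledClique H B l) :
    ∃ l', IsLabelledClique (H.map φ) (B.map φ) l' := by
  rcases isEmpty_or_nonempty W with hW | hW
  · refine ⟨fun a b => s(a, b), fun u hu => ?_⟩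
    simp only [Finset.mem_map] at hu
    obtain ⟨a, -⟩ := hu
    exact hW.elim a
  · refine ⟨fun a b => Sym2.map φ (l (Function.invFun φ a) (Function.invFun φ b)), ?_⟩
    intro u hu v hv huv
    simp only [Finset.mem_map] at hu hv
    obtain ⟨i, hi, rfl⟩ := hu
    obtain ⟨j, hj, rfl⟩ := hv
    refine (h i hi j hj fun h => huv (by rw [h])).map
      (⟨φ, ?_⟩ : labelGraph H l s(i, j) →g labelGraph (H.map φ) _ s(φ i, φ j))
    intro a b hab
    have hinv := Function.leftInverse_invFun φ.injective
    refine ⟨(SimpleGraph.map_adj_apply).2 hab.1, ?_, ?_⟩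
    · beta_reduce; rw [hinv a, hinv b, hab.2.1]; rfl
    · beta_reduce; rw [hinv a, hinv b, hab.2.2]; rfl

/-- A clique immersion in an induced subgraph, as a labelling of the ambient vertex set. -/
theorem HasCliqueImmersion.exists_of_induce {V : Type*} {G : SimpleGraph V} {S : Set V} {k : ℕ}
    (h : HasCliqueImmersion (G.induce S) k) : ∃ B : Finset V, B.card = k ∧ (∀ b ∈ B, b ∈ S) ∧
      ∃ l, IsLabelledClique ((G.induce S).map (Function.Embedding.subtype (· ∈ S))) B l := by
  obtain ⟨B, rfl, l, hl⟩ := h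
  refine ⟨B.map (Function.Embedding.subtype (· ∈ S)), by simp, ?_, hl.exists_map _⟩
  intro b hb
  obtain ⟨⟨a, ha⟩, -, rfl⟩ := Finset.mem_map.1 hb
  exact ha

theorem map_induce_adj {V : Type*} {G : SimpleGraph V} {S : Set V} {a b : V} :
    ((G.induce S).map (Function.Embedding.subtype (· ∈ S))).Adj a b ↔
      a ∈ S ∧ b ∈ S ∧ G.Adj a b := by
  simp only [SimpleGraph.map_adj, comap_adj, Function.Embedding.subtype_apply, Subtype.exists]
  constructor
  · rintro ⟨a, ha, b, hb, h, rfl, rfl⟩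
    exact ⟨ha, hb, h⟩
  · rintro ⟨ha, hb, h⟩
    exact ⟨a, ha, b, hb, h, rfl, rfl⟩

theorem HasCliqueImmersion.of_induce {V : Type*} {G : SimpleGraph V} {S : Set V} {k : ℕ}
    (h : HasCliqueImmersion (G.induce S) k) : HasCliqueImmersion G k := by
  obtain ⟨B, hB, -, l, hl⟩ := h.exists_of_induce
  exact ⟨B, hB, l, hl.mono fun a b hab => (map_induce_adj.1 hab).2.2⟩

theorem HasCliqueImmersion.of_isClique {V : Type*} {G : SimpleGraph V} {B : Finset V}
    (h : G.IsClique B) : HasCliqueImmersion G B.card :=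
  ⟨B, rfl, fun a b => s(a, b), fun _ hu _ hv huv =>
    Adj.reachable ⟨h hu hv huv, rfl, Sym2.eq_swap⟩⟩

/-- If all edges between `S` and its complement are present, then clique immersions in the two
parts can be joined. -/
theorem HasCliqueImmersion.join {V : Type*} {G : SimpleGraph V} {S : Set V} {j k : ℕ}
    (hS : ∀ a ∈ S, ∀ b ∉ S, G.Adj a b) (h₁ : HasCliqueImmersion (G.induce S) j)
    (h₂ : HasCliqueImmersion (G.induce Sᶜ) k) : HasCliqueImmersion G (j + k) := by
  classical
  obtain ⟨B₁, rfl, hB₁, l₁, hl₁⟩ := h₁.exists_of_induce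
  obtain ⟨B₂, rfl, hB₂, l₂, hl₂⟩ := h₂.exists_of_induce
  have hdisj : Disjoint B₁ B₂ :=
    Finset.disjoint_left.2 fun a ha ha' => hB₂ a ha' (hB₁ a ha)
  -- Each part keeps its own labels; a crossing edge directly joins its two ends.
  let l : V → V → Sym2 V := fun a b =>
    if a ∈ S ∧ b ∈ S then l₁ a b else if a ∉ S ∧ b ∉ S then l₂ a b else s(a, b)
  refine ⟨B₁ ∪ B₂, Finset.card_union_of_disjoint hdisj, l, ?_⟩
  intro u hu v hv huv
  rcases Finset.mem_union.1 hu with hu | hu <;> rcases Finset.mem_union.1 hv with hv | hv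
  · refine (hl₁ u hu v hv huv).mono fun a b hab => ?_
    obtain ⟨ha, hb, hab'⟩ := map_induce_adj.1 hab.1
    refine ⟨hab', ?_, ?_⟩
    · simp [l, ha, hb, hab.2.1]
    · simp [l, ha, hb, hab.2.2]
  · have h1 := hB₁ u hu
    have h2 := hB₂ v hv
    have h2' : v ∉ S := h2
    exact Adj.reachable ⟨hS u h1 v h2, by simp [l, h1, h2'], by simp [l, h1, h2', Sym2.eq_swap]⟩
  · have h1 := hB₁ v hv
    have h2 := hB₂ u hu
    have h2' : u ∉ S := h2
    exact Adj.reachable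
      ⟨(hS v h1 u h2).symm, by simp [l, h1, h2'], by simp [l, h1, h2', Sym2.eq_swap]⟩
  · refine (hl₂ u hu v hv huv).mono fun a b hab => ?_
    obtain ⟨ha, hb, hab'⟩ := map_induce_adj.1 hab.1
    have ha' : a ∉ S := ha
    have hb' : b ∉ S := hb
    refine ⟨hab', ?_, ?_⟩
    · simp [l, ha', hb', hab.2.1]
    · simp [l, ha', hb', hab.2.2]

/-! ### Gallai's lemma -/

/-- `f` is an involution that matches every vertex it moves to a neighbour. -/
structure IsPairing {V : Type*} (F : SimpleGraph V) (f : V → V) : Prop where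
  invol : ∀ a, f (f a) = a
  adj : ∀ a, f a ≠ a → F.Adj a (f a)

/-- The set of vertices left unmatched by `f`. -/
def fixedFinset {V : Type*} [Fintype V] [DecidableEq V] (f : V → V) : Finset V :=
  Finset.univ.filter fun a => f a = a

theorem mem_fixedFinset {V : Type*} [Fintype V] [DecidableEq V] {f : V → V} {a : V} :
    a ∈ fixedFinset f ↔ f a = a := by simp [fixedFinset]

/-- A pairing with the fewest unmatched vertices. -/
structure IsMinPairing {V : Type*} [Fintype V] [DecidableEq V] (F : SimpleGraph V) (f : V → V) :
    Prop extends IsPairing F f where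
  le : ∀ g, IsPairing F g → (fixedFinset f).card ≤ (fixedFinset g).card

section Gallai

variable {V : Type*} [Fintype V] [DecidableEq V] {F : SimpleGraph V}

theorem IsMinPairing.not_adj_of_fixed {f : V → V} (hf : IsMinPairing F f) {u w : V}
    (hu : f u = u) (hw : f w = w) : ¬ F.Adj u w := by
  intro h
  have hne := h.ne
  have hinv := hf.invol
  let g : V → V := fun a => if a = u then w else if a = w then u else f a
  have hg : IsPairing F g := by
    constructor
    · intro a; simp only [g]; grind
    · intro a ha
      by_cases h1 : a = u
      · simpa [g, h1] using h
      by_cases h2 : a = w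
      · simpa [g, h2, hne.symm] using h.symm
      simp only [g, h1, h2, if_false] at ha ⊢
      exact hf.adj a ha
  refine (hf.le g hg).not_gt (Finset.card_lt_card ?_)
  rw [Finset.ssubset_iff_of_subset]
  · exact ⟨u, mem_fixedFinset.2 hu, by simp [mem_fixedFinset, g, hne.symm]⟩
  · intro a ha
    rw [mem_fixedFinset] at ha ⊢
    simp only [g] at ha
    grind

/-- Exchange step: `M` moves `x`, `N` fixes `x`; then `N` can be changed at `x` so that it agrees
with `M` on a larger set. -/
theorem IsMinPairing.exists_exchange {M N : V → V} (hM : IsPairing F M) (hN : IsMinPairing F N)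
    {w x : V} (hw : N w = w) (hx : N x = x) (hxw : x ≠ w) (hMx : M x ≠ x) :
    ∃ N', IsMinPairing F N' ∧ N' w = w ∧
      (Finset.univ.filter fun a => M a = N a).card <
        (Finset.univ.filter fun a => M a = N' a).card := by
  obtain ⟨y, hy⟩ : ∃ y, M x = y := ⟨_, rfl⟩
  have hxy : F.Adj x y := hy ▸ hM.adj x hMx
  have hMy : M y = x := by rw [← hy, hM.invol]
  have hNy : N y ≠ y := fun h => hN.not_adj_of_fixed hx h hxy
  obtain ⟨z, hz⟩ : ∃ z, N y = z := ⟨_, rfl⟩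
  have hNz : N z = y := by rw [← hz, hN.invol]
  have hinv := hN.invol
  have hMinv := hM.invol
  have hxny := hxy.ne
  have hzx : z ≠ x := by grind
  have hzy : z ≠ y := by grind
  -- The edge `yz` of `N` is traded for the edge `xy` of `M`, so `z` replaces `x` as an unmatched
  -- vertex.
  let N' : V → V := fun a => if a = x then y else if a = y then x else if a = z then z else N a
  have hN' : IsPairing F N' := by
    constructor
    · intro a; simp only [N']; grind
    · intro a ha
      by_cases h1 : a = x
      · simpa [N', h1] using hxy
      by_cases h2 : a = y
      · simpa [N', h2, hxny.symm] using hxy.symm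
      by_cases h3 : a = z
      · simp [N', h3, hzx, hzy] at ha
      simp only [N', h1, h2, h3, if_false] at ha ⊢
      exact hN.adj a ha
  have hcard : (fixedFinset N').card ≤ (fixedFinset N).card := by
    have hsub : fixedFinset N' ⊆ insert z ((fixedFinset N).erase x) := by
      intro a ha
      simp only [Finset.mem_insert, Finset.mem_erase]
      rw [mem_fixedFinset] at ha ⊢
      simp only [N'] at ha
      grind
    refine (Finset.card_le_card hsub).trans ((Finset.card_insert_le _ _).trans ?_)
    rw [Finset.card_erase_of_mem (mem_fixedFinset.2 hx)]
    have : 0 < (fixedFinset N).card := Finset.card_pos.2 ⟨x, mem_fixedFinset.2 hx⟩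
    omega
  refine ⟨N', ⟨hN', fun g hg => hcard.trans (hN.le g hg)⟩, ?_, Finset.card_lt_card ?_⟩
  · simp only [N']; grind
  -- The agreement at `y` is new, and none is lost at `z`, because `M` matches `y` to `x`.
  · rw [Finset.ssubset_iff_of_subset]
    · exact ⟨y, by simp [N', hMy, hxny.symm], by simp [hMy, hz, hzx.symm]⟩
    · intro a ha
      simp only [Finset.mem_filter, Finset.mem_univ, true_and] at ha ⊢
      simp only [N']
      grind

/-- If every vertex is missed by a minimum pairing, then two vertices joined by a walk are not both
missed by the same minimum pairing. -/
theorem IsMinPairing.not_fixed_of_walk (hcrit : ∀ v, ∃ f, IsMinPairing F f ∧ f v = v) {u v : V}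
    (p : F.Walk u v) (huv : u ≠ v) {M : V → V} (hM : IsMinPairing F M) (hu : M u = u) :
    M v ≠ v := by
  induction p generalizing M with
  | nil => exact (huv rfl).elim
  | @cons u w v h p ih =>
    intro hv
    rcases eq_or_ne w v with rfl | hwv
    · exact hM.not_adj_of_fixed hu hv h
    classical
    replace ih := @ih hwv
    let S : Finset (V → V) :=
      Finset.univ.filter fun N => IsMinPairing F N ∧ N w = w
    have hS : S.Nonempty := by
      obtain ⟨N, hN⟩ := hcrit w
      exact ⟨N, by simpa [S] using hN⟩
    obtain ⟨N, hNS, hmax⟩ := S.exists_max_image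
      (fun N => (Finset.univ.filter fun a => M a = N a).card) hS
    obtain ⟨hN, hw⟩ : IsMinPairing F N ∧ N w = w := by simpa [S] using hNS
    have hNu : N u ≠ u := fun hu' => hN.not_adj_of_fixed hu' hw h
    have hNv : N v ≠ v := ih hN hw
    have hle : (fixedFinset N).card = (fixedFinset M).card :=
      le_antisymm (hN.le _ hM.toIsPairing) (hM.le _ hN.toIsPairing)
    -- `M` and `N` miss equally many vertices and only `M` misses `u` and `v`, so at least two are
    -- missed by `N` only. One of them is not `w`, and exchanging there contradicts the maximal
    -- agreement.
    have h2 : 1 < (fixedFinset N \ fixedFinset M).card := by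
      rw [Finset.card_sdiff_comm hle, Finset.one_lt_card]
      exact ⟨u, by simp [mem_fixedFinset, hu, hNu], v, by simp [mem_fixedFinset, hv, hNv], huv⟩
    obtain ⟨x, hx, hxw⟩ := Finset.exists_mem_ne h2 w
    rw [Finset.mem_sdiff, mem_fixedFinset, mem_fixedFinset] at hx
    obtain ⟨N', hN', hw', hlt⟩ := IsMinPairing.exists_exchange hM.toIsPairing hN hw hx.1 hxw hx.2
    exact (hmax N' (by simpa [S] using ⟨hN', hw'⟩)).not_gt hlt

/-- Gallai's lemma: if `F` is connected and every vertex is missed by a maximum matching, then `F`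
is factor-critical. -/
theorem exists_pairing_fixed_iff_eq (hF : F.Preconnected)
    (hcrit : ∀ v, ∃ f, IsMinPairing F f ∧ f v = v) (v : V) :
    ∃ f, IsPairing F f ∧ ∀ a, f a = a ↔ a = v := by
  obtain ⟨f, hf, hv⟩ := hcrit v
  refine ⟨f, hf.toIsPairing, fun a => ⟨fun ha => ?_, fun h => h ▸ hv⟩⟩
  by_contra hne
  obtain ⟨p⟩ := hF v a
  exact IsMinPairing.not_fixed_of_walk hcrit p (Ne.symm hne) hf hv ha

end Gallai

/-! ### Colourings as matchings of the complement -/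

/-- The independence number is at most two. -/
def HasNoIndepTriple {V : Type*} (G : SimpleGraph V) : Prop :=
  ∀ a b c, a ≠ b → a ≠ c → b ≠ c → G.Adj a b ∨ G.Adj a c ∨ G.Adj b c

theorem HasNoIndepTriple.of_indepNum_le {V : Type*} [Finite V] {G : SimpleGraph V}
    (h : G.indepNum ≤ 2) : HasNoIndepTriple G := by
  classical
  intro a b c hab hac hbc
  by_contra! hne
  have hs : G.IsIndepSet ({a, b, c} : Finset V) := by
    intro x hx y hy hxy
    simp only [Finset.coe_insert, Finset.coe_singleton, Set.mem_insert_iff,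
      Set.mem_singleton_iff] at hx hy
    rcases hx with rfl | rfl | rfl <;> rcases hy with rfl | rfl | rfl <;>
      simp_all [G.adj_comm]
  have := hs.card_le_indepNum
  rw [Finset.card_eq_three.2 ⟨a, b, c, hab, hac, hbc, rfl⟩] at this
  omega

theorem HasNoIndepTriple.indepNum_le {V : Type*} [Finite V] {G : SimpleGraph V}
    (h : HasNoIndepTriple G) : G.indepNum ≤ 2 := by
  classical
  obtain ⟨s, hs⟩ := G.exists_isNIndepSet_indepNum
  by_contra! hlt
  rw [← hs.card_eq] at hlt
  obtain ⟨a, b, c, ha, hb, hc, hab, hac, hbc⟩ := Finset.two_lt_card_iff.1 hlt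
  rcases h a b c hab hac hbc with h | h | h
  · exact hs.isIndepSet ha hb hab h
  · exact hs.isIndepSet ha hc hac h
  · exact hs.isIndepSet hb hc hbc h

theorem HasNoIndepTriple.induce {V : Type*} {G : SimpleGraph V} (h : HasNoIndepTriple G)
    (S : Set V) : HasNoIndepTriple (G.induce S) := by
  intro a b c hab hac hbc
  exact h a b c (fun h => hab (Subtype.ext h)) (fun h => hac (Subtype.ext h))
    (fun h => hbc (Subtype.ext h))

/-- The classes are the sets `{a, f a}`. Each contributes at least two to the left-hand side: a
matched pair by its two vertices, an unmatched vertex by being counted twice. -/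
theorem colorable_of_isPairing {V : Type*} [Fintype V] [DecidableEq V] {G : SimpleGraph V}
    {f : V → V} (hf : IsPairing Gᶜ f) {k : ℕ}
    (hk : Fintype.card V + (fixedFinset f).card ≤ 2 * k) : G.Colorable k := by
  let c : V → Finset V := fun a => {a, f a}
  let T : Finset (Finset V) := Finset.univ.image c
  have hcT : ∀ a, c a ∈ T := fun a => Finset.mem_image_of_mem _ (Finset.mem_univ a)
  have hcf : ∀ a, c (f a) = c a := fun a => by simp only [c, hf.invol, Finset.pair_comm]
  have hT : 2 * T.card ≤ Fintype.card V + (fixedFinset f).card := by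
    have h1 := Finset.card_eq_sum_card_fiberwise (s := Finset.univ) (t := T) (f := c)
      (fun a _ => hcT a)
    have h2 := Finset.card_eq_sum_card_fiberwise (s := fixedFinset f) (t := T) (f := c)
      (fun a _ => hcT a)
    rw [← Finset.card_univ, h1, h2, ← Finset.sum_add_distrib, mul_comm, ← smul_eq_mul]
    refine Finset.card_nsmul_le_sum _ _ _ fun s hs => ?_
    obtain ⟨a, -, rfl⟩ := Finset.mem_image.1 hs
    by_cases ha : f a = a
    · have h1 : 0 < (Finset.univ.filter fun b => c b = c a).card :=
        Finset.card_pos.2 ⟨a, by simp⟩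
      have h2 : 0 < ((fixedFinset f).filter fun b => c b = c a).card :=
        Finset.card_pos.2 ⟨a, by simp [mem_fixedFinset, ha]⟩
      omega
    · have h1 : 1 < (Finset.univ.filter fun b => c b = c a).card :=
        Finset.one_lt_card.2 ⟨a, by simp, f a, by simp [hcf], fun h => ha h.symm⟩
      omega
  let C : G.Coloring T := Coloring.mk (fun a => ⟨c a, hcT a⟩) (by
    intro a b hab h
    have h : c a = c b := congrArg Subtype.val h
    have hb : b ∈ c a := h ▸ Finset.mem_insert_self _ _
    simp only [c, Finset.mem_insert, Finset.mem_singleton] at hb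
    rcases hb with rfl | rfl
    · exact hab.ne rfl
    · exact ((compl_adj _ _ _).1 (hf.adj a hab.ne.symm)).2 hab)
  have := C.colorable
  rw [Fintype.card_coe] at this
  exact this.mono (by omega)

/-- No colour occurs three times, so vertices of equal colour can be matched. A colour used once
counts twice, hence every colour contributes at most two. -/
theorem exists_isPairing_of_colorable {V : Type*} [Fintype V] [DecidableEq V] {G : SimpleGraph V}
    (hG : HasNoIndepTriple G) {k : ℕ} (hk : G.Colorable k) :
    ∃ f, IsPairing Gᶜ f ∧ Fintype.card V + (fixedFinset f).card ≤ 2 * k := by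
  obtain ⟨c⟩ := hk
  have hc : ∀ a b, c a = c b → ¬ G.Adj a b := fun a b h hab => c.valid hab h
  have huniq : ∀ a b d, b ≠ a → c b = c a → d ≠ a → c d = c a → b = d := by
    intro a b d hb hcb hd hcd
    by_contra hne
    rcases hG a b d hb.symm hd.symm hne with h | h | h
    · exact hc _ _ hcb.symm h
    · exact hc _ _ hcd.symm h
    · exact hc _ _ (hcb.trans hcd.symm) h
  let f : V → V := fun a => if h : ∃ b, b ≠ a ∧ c b = c a then h.choose else a
  have hf1 : ∀ a, (∃ b, b ≠ a ∧ c b = c a) → f a ≠ a ∧ c (f a) = c a := by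
    intro a h
    have : f a = h.choose := dif_pos h
    rw [this]
    exact h.choose_spec
  have hf2 : ∀ a, ¬ (∃ b, b ≠ a ∧ c b = c a) → f a = a := fun a h => dif_neg h
  have hf : IsPairing Gᶜ f := by
    constructor
    · intro a
      by_cases h : ∃ b, b ≠ a ∧ c b = c a
      · obtain ⟨h1, h2⟩ := hf1 a h
        obtain ⟨h3, h4⟩ := hf1 (f a) ⟨a, h1.symm, h2.symm⟩
        exact huniq (f a) _ _ h3 h4 h1.symm h2.symm
      · rw [hf2 a h, hf2 a h]
    · intro a ha
      by_cases h : ∃ b, b ≠ a ∧ c b = c a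
      · exact (compl_adj _ _ _).2 ⟨ha.symm, hc _ _ (hf1 a h).2.symm⟩
      · exact (ha (hf2 a h)).elim
  refine ⟨f, hf, ?_⟩
  have h1 := Finset.card_eq_sum_card_fiberwise (s := (Finset.univ : Finset V))
    (t := Finset.univ) (f := c) (fun a _ => Finset.mem_univ _)
  have h2 := Finset.card_eq_sum_card_fiberwise (s := fixedFinset f) (t := Finset.univ) (f := c)
    (fun a _ => Finset.mem_univ _)
  rw [← Finset.card_univ, h1, h2, ← Finset.sum_add_distrib]
  refine (Finset.sum_le_card_nsmul _ _ 2 fun i _ => ?_).trans (by simp [mul_comm])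
  by_cases h : ∃ a, f a = a ∧ c a = i
  · obtain ⟨a, ha, rfl⟩ := h
    have hs : ∀ b, c b = c a → b = a := by
      intro b hb
      by_contra hne
      exact (hf1 a ⟨b, hne, hb⟩).1 ha
    have h1 : (Finset.univ.filter fun b => c b = c a) ⊆ {a} := by
      intro b hb
      simpa using hs b (by simpa using hb)
    have h2 : ((fixedFinset f).filter fun b => c b = c a) ⊆ {a} := by
      intro b hb
      simpa using hs b (Finset.mem_filter.1 hb).2
    have h1 := Finset.card_le_card h1
    have h2 := Finset.card_le_card h2
    simp only [Finset.card_singleton] at h1 h2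
    omega
  · have h2 : ((fixedFinset f).filter fun b => c b = i) = ∅ := by
      ext b
      simp only [Finset.mem_filter, mem_fixedFinset, Finset.notMem_empty, iff_false]
      exact fun hb => h ⟨b, hb⟩
    rw [h2, Finset.card_empty, add_zero]
    by_contra! hlt
    obtain ⟨a, b, d, ha, hb, hd, hab, had, hbd⟩ := Finset.two_lt_card_iff.1 hlt
    simp only [Finset.mem_filter, Finset.mem_univ, true_and] at ha hb hd
    exact hbd (huniq a b d hab.symm (hb.trans ha.symm) had.symm (hd.trans ha.symm))

theorem isCounterexample_iff {V : Type*} [Finite V] {G : SimpleGraph V} :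
    IsCounterexample G ↔ HasNoIndepTriple G ∧
      ∃ t : ℕ, G.chromaticNumber = t ∧ ¬ HasCliqueImmersion G t := by
  simp only [IsCounterexample, immersed_completeGraph_iff]
  exact and_congr_left fun _ => ⟨HasNoIndepTriple.of_indepNum_le, HasNoIndepTriple.indepNum_le⟩

theorem exists_chromaticNumber_eq_natCast {V : Type*} [Finite V] (G : SimpleGraph V) :
    ∃ t : ℕ, G.chromaticNumber = t ∧ ∀ k, G.Colorable k ↔ t ≤ k := by
  have : Fintype V := Fintype.ofFinite V
  have h := G.colorable_of_fintype
  obtain ⟨t, ht⟩ := ENat.ne_top_iff_exists.1 (chromaticNumber_ne_top_iff_exists.2 ⟨_, h⟩)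
  refine ⟨t, ht.symm, fun k => ?_⟩
  rw [← chromaticNumber_le_iff_colorable, ← ht, Nat.cast_le]

theorem HasNoIndepTriple.exists_colorable_hasCliqueImmersion {V : Type*} [Finite V]
    {G : SimpleGraph V} (hG : HasNoIndepTriple G) (hn : ¬ IsCounterexample G) :
    ∃ t, (∀ k, G.Colorable k ↔ t ≤ k) ∧ HasCliqueImmersion G t := by
  obtain ⟨t, ht, hk⟩ := exists_chromaticNumber_eq_natCast G
  refine ⟨t, hk, ?_⟩
  by_contra h
  exact hn (isCounterexample_iff.2 ⟨hG, t, ht, h⟩)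

/-- The moved vertices come in pairs. Parity turns a strict inequality against `2 * t` into the
saving of a whole colour. -/
theorem IsPairing.even_card_add {V : Type*} [Fintype V] [DecidableEq V] {F : SimpleGraph V}
    {f : V → V} (hf : IsPairing F f) : Even (Fintype.card V + (fixedFinset f).card) := by
  have h : ((Finset.univ.filter fun a => f a ≠ a).card : ZMod 2) = 0 := by
    rw [Finset.cast_card]
    refine Finset.sum_involution (fun a _ => f a) (fun _ _ => by decide) (fun a ha _ => ?_)
      (fun a ha => ?_) (fun a _ => hf.invol a)
    · simpa using ha
    · simp only [Finset.mem_filter, Finset.mem_univ, true_and] at ha ⊢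
      rw [hf.invol]
      exact ha.symm
  rw [ZMod.natCast_eq_zero_iff_even] at h
  have h2 := Finset.card_filter_add_card_filter_not (s := (Finset.univ : Finset V))
    (fun a => f a = a)
  rw [Finset.card_univ] at h2
  rw [← h2]
  change Even (_ + _ + (Finset.univ.filter fun a => f a = a).card)
  rw [add_right_comm]
  exact (Even.add_self _).add h

theorem exists_isPairing_fixed_of_induce_colorable {V : Type*} [Fintype V] [DecidableEq V]
    {G : SimpleGraph V} (hG : HasNoIndepTriple G) {k : ℕ} (v : V)
    (hk : (G.induce {w | w ≠ v}).Colorable k) :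
    ∃ f, IsPairing Gᶜ f ∧ f v = v ∧ Fintype.card V + (fixedFinset f).card ≤ 2 * (k + 1) := by
  classical
  obtain ⟨f, hf, hle⟩ := exists_isPairing_of_colorable (hG.induce _) hk
  let g : V → V := fun a => if h : a ≠ v then (f ⟨a, h⟩).1 else v
  have hgv : g v = v := dif_neg (by simp)
  have hg : ∀ a : {w | w ≠ v}, g a = f a := fun a => dif_pos a.2
  have hgp : IsPairing Gᶜ g := by
    constructor
    · intro a
      by_cases h : a = v
      · rw [h, hgv, hgv]
      · rw [hg ⟨a, h⟩, hg, hf.invol]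
    · intro a ha
      by_cases h : a = v
      · exact (ha (h ▸ hgv)).elim
      · rw [hg ⟨a, h⟩] at ha ⊢
        have := hf.adj ⟨a, h⟩ fun h' => ha (congrArg Subtype.val h')
        rw [compl_adj] at this ⊢
        exact ⟨fun h' => this.1 (Subtype.ext h'), this.2⟩
  refine ⟨g, hgp, hgv, ?_⟩
  have hfix : fixedFinset g ⊆ insert v ((fixedFinset f).map (Function.Embedding.subtype _)) := by
    intro a ha
    rw [mem_fixedFinset] at ha
    by_cases h : a = v
    · simp [h]
    · refine Finset.mem_insert_of_mem (Finset.mem_map.2 ⟨⟨a, h⟩, ?_, rfl⟩)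
      rw [mem_fixedFinset]
      exact Subtype.ext ((hg ⟨a, h⟩).symm.trans ha)
  have h1 := (Finset.card_le_card hfix).trans (Finset.card_insert_le _ _)
  rw [Finset.card_map] at h1
  have h2 : Fintype.card {w | w ≠ v} = Fintype.card V - 1 := by
    simp [Finset.filter_ne', Finset.card_erase_of_mem]
  have h3 : 0 < Fintype.card V := Fintype.card_pos_iff.2 ⟨v⟩
  omega

theorem Colorable.join {V : Type*} {G : SimpleGraph V} {S : Set V} {j k : ℕ}
    (h₁ : (G.induce S).Colorable j) (h₂ : (G.induce Sᶜ).Colorable k) : G.Colorable (j + k) := by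
  classical
  obtain ⟨c₁⟩ := h₁
  obtain ⟨c₂⟩ := h₂
  let C : G.Coloring (Fin j ⊕ Fin k) := Coloring.mk
    (fun a => if h : a ∈ S then Sum.inl (c₁ ⟨a, h⟩) else Sum.inr (c₂ ⟨a, h⟩)) (by
      intro a b hab h
      by_cases ha : a ∈ S <;> by_cases hb : b ∈ S
      · rw [dif_pos ha, dif_pos hb] at h
        exact c₁.valid (v := ⟨a, ha⟩) (w := ⟨b, hb⟩) hab (Sum.inl_injective h)
      · simp [ha, hb] at h
      · simp [ha, hb] at h
      · rw [dif_neg ha, dif_neg hb] at h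
        exact c₂.valid (v := ⟨a, ha⟩) (w := ⟨b, hb⟩) hab (Sum.inr_injective h))
  simpa using C.colorable

/-! ### Minimal counterexamples have factor-critical complement -/

/-- The complement of `G` is factor-critical. -/
def HasNearPairings {V : Type*} (G : SimpleGraph V) : Prop :=
  ∀ v, ∃ f, IsPairing Gᶜ f ∧ ∀ a, f a = a ↔ a = v

/-- Either a counterexample contains a smaller one, or its complement is factor-critical. -/
theorem IsCounterexample.hasNearPairings_or {V : Type*} [Finite V] {G : SimpleGraph V}
    (hG : IsCounterexample G) (hmin : ∀ S : Set V, S ≠ Set.univ → ¬ IsCounterexample (G.induce S)) :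
    HasNearPairings G ∧
      ∃ t : ℕ, G.chromaticNumber = t ∧ Nat.card V + 1 = 2 * t ∧ (∀ k, G.Colorable k ↔ t ≤ k) ∧
        ¬ HasCliqueImmersion G t := by
  classical
  have : Fintype V := Fintype.ofFinite V
  obtain ⟨hα, t, ht, hno⟩ := isCounterexample_iff.1 hG
  have hcol : ∀ k, G.Colorable k ↔ t ≤ k := fun k => by
    rw [← chromaticNumber_le_iff_colorable, ht, Nat.cast_le]
  have ht0 : 0 < t := by
    rcases Nat.eq_zero_or_pos t with rfl | h
    · exact (hno ⟨∅, rfl, fun a b => s(a, b), by simp [IsLabelledClique]⟩).elim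
    · exact h
  have hV : Nonempty V := by
    by_contra hV
    rw [not_nonempty_iff] at hV
    have := (hcol 0).1 ⟨Coloring.mk (fun a => isEmptyElim a) fun {a} => isEmptyElim a⟩
    omega
  -- The clique immersion of `G - v` lives in `G`, so `G - v` needs fewer than `t` colours. By
  -- `hlow` below, the resulting matching missing `v` is maximum.
  have hcrit : ∀ v, ∃ f, IsPairing Gᶜ f ∧ f v = v ∧
      Fintype.card V + (fixedFinset f).card ≤ 2 * t := by
    intro v
    obtain ⟨k, hk, hi⟩ := (hα.induce {w | w ≠ v}).exists_colorable_hasCliqueImmersion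
      (hmin _ fun h => (h ▸ Set.mem_univ v : v ∈ {w | w ≠ v}) rfl)
    have hlt : k < t := by
      by_contra! hle
      exact hno (hi.of_induce.le hle)
    obtain ⟨f, hf, hv, hle⟩ := exists_isPairing_fixed_of_induce_colorable hα v ((hk k).2 le_rfl)
    exact ⟨f, hf, hv, by omega⟩
  have hlow : ∀ f, IsPairing Gᶜ f → 2 * t ≤ Fintype.card V + (fixedFinset f).card := by
    intro f hf
    by_contra! hlt
    obtain ⟨m, hm⟩ := hf.even_card_add
    have := (hcol (t - 1)).1 (colorable_of_isPairing hf (by omega))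
    omega
  -- A component of the complement is completely joined to the rest in `G`; the immersions and the
  -- colourings of both parts add up.
  have hconn : Gᶜ.Preconnected := by
    by_contra hnot
    simp only [Preconnected, not_forall] at hnot
    obtain ⟨u, v, huv⟩ := hnot
    let S : Set V := {w | Gᶜ.Reachable u w}
    have hu : u ∈ S := Reachable.refl u
    have hv : v ∉ S := huv
    have hS : ∀ a ∈ S, ∀ b ∉ S, G.Adj a b := by
      intro a ha b hb
      by_contra hab
      refine hb (Reachable.trans ha (Adj.reachable ((compl_adj _ _ _).2 ⟨?_, hab⟩)))
      rintro rfl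
      exact hb ha
    obtain ⟨j, hj, hij⟩ := (hα.induce S).exists_colorable_hasCliqueImmersion
      (hmin _ fun h => hv (h ▸ Set.mem_univ v))
    obtain ⟨k, hk, hik⟩ := (hα.induce Sᶜ).exists_colorable_hasCliqueImmersion
      (hmin _ fun h => (h ▸ Set.mem_univ u : u ∈ Sᶜ) hu)
    exact hno ((HasCliqueImmersion.join hS hij hik).le
      ((hcol _).1 (Colorable.join ((hj j).2 le_rfl) ((hk k).2 le_rfl))))
  have hnear : HasNearPairings G := by
    refine exists_pairing_fixed_iff_eq hconn fun v => ?_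
    obtain ⟨f, hf, hv, hle⟩ := hcrit v
    exact ⟨f, ⟨hf, fun g hg => by have := hlow g hg; omega⟩, hv⟩
  refine ⟨hnear, t, ht, ?_, hcol, hno⟩
  -- `f` leaves exactly one vertex unmatched, giving `2t ≤ n + 1`; `g` leaves at least one, giving
  -- `n + 1 ≤ 2t`.
  obtain ⟨v⟩ := hV
  obtain ⟨f, hf, hv⟩ := hnear v
  obtain ⟨g, hg, hgv, hle⟩ := hcrit v
  have h1 : (fixedFinset f).card = 1 :=
    Finset.card_eq_one.2 ⟨v, by ext a; simp [mem_fixedFinset, hv]⟩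
  have h2 : 0 < (fixedFinset g).card := Finset.card_pos.2 ⟨v, mem_fixedFinset.2 hgv⟩
  have h3 := hlow f hf
  rw [Nat.card_eq_fintype_card]
  omega

/-- Every counterexample `H` gives a counterexample with `2χ - 1` vertices and at most as large a
chromatic number. -/
theorem IsCounterexample.exists_card_add_one_eq {V : Type u} [Finite V] {G : SimpleGraph V}
    (hG : IsCounterexample G) :
    ∃ (W : Type u) (_ : Finite W) (H : SimpleGraph W) (t : ℕ), IsCounterexample H ∧
      H.chromaticNumber = t ∧ H.chromaticNumber ≤ G.chromaticNumber ∧ Nat.card W + 1 = 2 * t := by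
  induction hn : Nat.card V using Nat.strong_induction_on generalizing V with
  | _ n ih =>
    -- Either no proper induced subgraph is a counterexample, and then `n = 2χ - 1`, or the argument
    -- descends to one.
    by_cases hmin : ∀ S : Set V, S ≠ Set.univ → ¬ IsCounterexample (G.induce S)
    · obtain ⟨-, t, ht, hc, -⟩ := hG.hasNearPairings_or hmin
      exact ⟨V, inferInstance, G, t, hG, ht, le_rfl, hc⟩
    · push Not at hmin
      obtain ⟨S, hS, hcex⟩ := hmin
      have hlt : Nat.card S < n := by
        rw [← hn, Nat.card_coe_set_eq]
        exact Set.ncard_lt_card hS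
      obtain ⟨W, hW, H, t, h1, h2, h3, h4⟩ := ih _ hlt hcex rfl
      exact ⟨W, hW, H, t, h1, h2,
        h3.trans (chromaticNumber_mono_of_hom (Embedding.induce S).toHom), h4⟩

/-! ### Extending an immersion by one of two non-adjacent vertices -/

/-- If `x` and `y` are not adjacent, a clique immersion in `G - x - y` extends by `x` as soon as
the common neighbours of `x` and `y` outside its branch set outnumber the branch vertices that are
not adjacent to `x`. -/
theorem HasCliqueImmersion.insert_of_not_adj {V : Type*} [DecidableEq V] {G K : SimpleGraph V}
    {x y : V} {B D : Finset V} {l : V → V → Sym2 V}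
    (hK : ∀ a b, K.Adj a b → G.Adj a b ∧ a ≠ x ∧ a ≠ y ∧ b ≠ x ∧ b ≠ y)
    (hl : IsLabelledClique K B l) (hxB : x ∉ B) (hyB : y ∉ B)
    (hB : ∀ b ∈ B, ¬ G.Adj x b → G.Adj y b)
    (hD : ∀ c ∈ D, G.Adj x c ∧ G.Adj y c ∧ c ∉ B) {A : Finset V}
    (hA : ∀ b ∈ B, ¬ G.Adj x b → b ∈ A) (hcard : A.card ≤ D.card) :
    HasCliqueImmersion G (B.card + 1) := by
  classical
  -- Each `b` in `A` receives a private common neighbour `g b` for the path `x, g b, y, b`; `r`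
  -- sends `g b` back to `b`.
  obtain ⟨g⟩ : Nonempty (A ↪ D) :=
    Function.Embedding.nonempty_of_card_le (by simpa using hcard)
  let r : V → V := fun w => if h : ∃ b : A, (g b : V) = w then (h.choose : V) else w
  have hrB : ∀ b ∈ B, r b = b := by
    intro b hb
    refine dif_neg ?_
    rintro ⟨c, hc⟩
    exact (hD _ (g c).2).2.2 (hc ▸ hb)
  have hrg : ∀ b : A, r (g b) = b := by
    intro b
    have hex : ∃ b' : A, (g b' : V) = g b := ⟨b, rfl⟩
    have : r (g b) = hex.choose := dif_pos hex
    rw [this, g.injective (Subtype.ext hex.choose_spec)]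
  let l' : V → V → Sym2 V := fun a b =>
    if a = x ∨ a = y then s(x, r b) else if b = x ∨ b = y then s(x, r a) else l a b
  have hlx : ∀ b, b ≠ x → b ≠ y → l' x b = s(x, r b) ∧ l' b x = s(x, r b) := by
    intro b h1 h2
    simp [l', h1, h2]
  have hly : ∀ b, b ≠ x → b ≠ y → l' y b = s(x, r b) ∧ l' b y = s(x, r b) := by
    intro b h1 h2
    simp [l', h1, h2]
  have hxb : ∀ b ∈ B, (labelGraph G l' s(x, b)).Reachable x b := by
    intro b hb
    have hbx : b ≠ x := fun h => hxB (h ▸ hb)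
    have hby : b ≠ y := fun h => hyB (h ▸ hb)
    by_cases hadj : G.Adj x b
    · have := hlx b hbx hby
      rw [hrB b hb] at this
      exact Adj.reachable ⟨hadj, this⟩
    · have hbA := hA b hb hadj
      obtain ⟨c, hc⟩ : ∃ c, (g ⟨b, hbA⟩ : V) = c := ⟨_, rfl⟩
      obtain ⟨hxc, hyc, -⟩ := hD c (hc ▸ (g ⟨b, hbA⟩).2)
      have hrc : r c = b := by rw [← hc]; exact hrg ⟨b, hbA⟩
      have h1 := hlx c hxc.ne.symm hyc.ne.symm
      have h2 := hly c hxc.ne.symm hyc.ne.symm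
      have h3 := hly b hbx hby
      rw [hrc] at h1 h2
      rw [hrB b hb] at h3
      have e1 : (labelGraph G l' s(x, b)).Adj x c := ⟨hxc, h1⟩
      have e2 : (labelGraph G l' s(x, b)).Adj c y := ⟨hyc.symm, h2.symm⟩
      have e3 : (labelGraph G l' s(x, b)).Adj y b := ⟨hB b hb hadj, h3⟩
      exact e1.reachable.trans (e2.reachable.trans e3.reachable)
  refine ⟨insert x B, Finset.card_insert_of_notMem hxB, l', ?_⟩
  intro u hu v hv huv
  rcases Finset.mem_insert.1 hu with rfl | hu' <;> rcases Finset.mem_insert.1 hv with rfl | hv'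
  · exact (huv rfl).elim
  · exact hxb v hv'
  · rw [Sym2.eq_swap]
    exact (hxb u hu').symm
  · refine (hl u hu' v hv' huv).mono fun a b hab => ?_
    obtain ⟨hab', h1, h2, h3, h4⟩ := hK a b hab.1
    refine ⟨hab', ?_, ?_⟩
    · simp only [l', h1, h2, h3, h4, or_self, if_false, hab.2.1]
    · simp only [l', h1, h2, h3, h4, or_self, if_false, hab.2.2]

/-! ### Kempe chains around a vertex -/

section Kempe

variable {V : Type*} {G : SimpleGraph V} {f : V → V} {v : V}

theorem IsPairing.not_adj (hf : IsPairing Gᶜ f) (a : V) : ¬ G.Adj a (f a) := by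
  intro h
  exact ((compl_adj _ _ _).1 (hf.adj a h.ne.symm)).2 h

/-- A third vertex is adjacent to `b` or to its non-neighbour `f b`. This supplies the outer edges
of the chains `a, f b, f a, b`. -/
theorem HasNoIndepTriple.adj_pairing (hα : HasNoIndepTriple G) (hf : IsPairing Gᶜ f)
    {a b : V} (hb : f b ≠ b) (hab : ¬ G.Adj a b) (hne : a ≠ b) (hne' : a ≠ f b) :
    G.Adj a (f b) := by
  rcases hα a b (f b) hne hne' hb.symm with h | h | h
  · exact (hab h).elim
  · exact h
  · exact (hf.not_adj b h).elim

theorem HasNoIndepTriple.adj_of_not_adj (hα : HasNoIndepTriple G) {a b : V}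
    (ha : a ≠ v) (hb : b ≠ v) (hva : ¬ G.Adj v a) (hvb : ¬ G.Adj v b) (hab : a ≠ b) :
    G.Adj a b := by
  rcases hα v a b ha.symm hb.symm hab with h | h | h
  · exact (hva h).elim
  · exact (hvb h).elim
  · exact h

/-- If the pairing matches all neighbours of `v` to non-neighbours, then `v` and its neighbours
are the branch vertices of an immersed complete graph. -/
theorem HasCliqueImmersion.of_pairing_neighbors [Fintype V] [DecidableEq V] [DecidableRel G.Adj]
    (hα : HasNoIndepTriple G) (hf : IsPairing Gᶜ f) (hv : ∀ a, f a = a ↔ a = v)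
    (hN : ∀ a, G.Adj v a → ¬ G.Adj v (f a)) : HasCliqueImmersion G (G.degree v + 1) := by
  have hinv := hf.invol
  -- `ρ` identifies the non-neighbour `f a` of `v` with the neighbour `a`. An edge serves the pair
  -- of its identified ends, so all three edges of `a, f b, f a, b` serve `a, b`.
  let ρ : V → V := fun a => if a = v then v else if G.Adj v a then a else f a
  have hρv : ρ v = v := by simp [ρ]
  have hρN : ∀ a, G.Adj v a → ρ a = a := fun a ha => by simp [ρ, ha, ha.ne']
  have hfv : ∀ a, G.Adj v a → f a ≠ v := fun a ha h => by
    have := (hv v).2 rfl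
    have := ha.ne
    grind
  have hρf : ∀ a, G.Adj v a → ρ (f a) = a := fun a ha => by
    simp [ρ, hfv a ha, hN a ha, hinv]
  have hadj : ∀ a b, G.Adj a b →
      (labelGraph G (fun a b => s(ρ a, ρ b)) s(ρ a, ρ b)).Adj a b :=
    fun a b h => ⟨h, rfl, Sym2.eq_swap⟩
  have hvx : ∀ a, G.Adj v a →
      (labelGraph G (fun a b => s(ρ a, ρ b)) s(v, a)).Reachable v a := by
    intro a ha
    have := hadj v a ha
    rw [hρv, hρN a ha] at this
    exact this.reachable
  refine ⟨insert v (G.neighborFinset v), ?_, fun a b => s(ρ a, ρ b), ?_⟩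
  · rw [Finset.card_insert_of_notMem (by simp), card_neighborFinset_eq_degree]
  intro a ha b hb hab
  simp only [Finset.mem_insert, mem_neighborFinset] at ha hb
  rcases ha with rfl | ha <;> rcases hb with rfl | hb
  · exact (hab rfl).elim
  · exact hvx b hb
  · rw [Sym2.eq_swap]
    exact (hvx a ha).symm
  · by_cases h : G.Adj a b
    · have := hadj a b h
      rw [hρN a ha, hρN b hb] at this
      exact this.reachable
    · have hne1 : a ≠ f b := fun h => hN b hb (h ▸ ha)
      have hne2 : b ≠ f a := fun h => hN a ha (h ▸ hb)
      have hfa : f a ≠ a := fun h => ha.ne ((hv a).1 h).symm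
      have hfb : f b ≠ b := fun h => hb.ne ((hv b).1 h).symm
      have e1 := hadj _ _ (hα.adj_pairing hf hfb h hab hne1)
      have e2 := hadj (f b) (f a) (hα.adj_of_not_adj (hfv b hb) (hfv a ha) (hN b hb) (hN a ha)
        fun h => hab (by rw [← hinv a, ← hinv b, h]))
      have e3 := hadj _ _ (hα.adj_pairing hf hfa (fun h' => h h'.symm) hab.symm hne2).symm
      rw [hρN a ha, hρf b hb] at e1
      rw [hρf a ha, hρf b hb, Sym2.eq_swap] at e2
      rw [hρf a ha, hρN b hb] at e3
      exact e1.reachable.trans (e2.reachable.trans e3.reachable)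

/-- If the pairing matches exactly two neighbours `p`, `f p` of `v` to each other and all other
neighbours to non-neighbours, then `v` and its neighbours other than `f p` are the branch vertices
of an immersed complete graph, provided that the pairs obstructing a direct connection to `p` can
be bypassed. -/
theorem HasCliqueImmersion.of_pairing_neighbors_except [Fintype V] [DecidableEq V]
    [DecidableRel G.Adj] (hα : HasNoIndepTriple G) (hf : IsPairing Gᶜ f)
    (hv : ∀ a, f a = a ↔ a = v) {p : V} (hp : G.Adj v p) (hq : G.Adj v (f p))
    (hN : ∀ a, G.Adj v a → G.Adj v (f a) → a = p ∨ a = f p)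
    (hbypass : ∀ y, y ≠ v → ¬ G.Adj v y → ¬ G.Adj p (f y) → ¬ G.Adj (f p) y →
      ∃ z, z ≠ v ∧ ¬ G.Adj v z ∧ z ≠ y ∧ G.Adj (f y) (f z) ∧ G.Adj (f y) z) :
    HasCliqueImmersion G (G.degree v) := by
  classical
  have hinv := hf.invol
  have hvv : f v = v := (hv v).2 rfl
  obtain ⟨K, hK⟩ : ∃ K : V → Prop, ∀ a, K a ↔ a ≠ v ∧ ¬ G.Adj v a := ⟨_, fun _ => Iff.rfl⟩
  -- `y` is bad when the chain `p, y, f p, f y` fails at its middle edge.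
  obtain ⟨bad, hbad⟩ : ∃ bad : V → Prop, ∀ y, bad y ↔ K y ∧ ¬ G.Adj p (f y) ∧ ¬ G.Adj (f p) y :=
    ⟨_, fun _ => Iff.rfl⟩
  -- With `z = J y`, the vertices `f y` and `f z` are adjacent and need no chain, so the edges `yz`
  -- and `z (f y)` are free for the pair `p, f y`.
  have hJ : ∀ y, ∃ z, bad y → K z ∧ z ≠ y ∧ G.Adj (f y) (f z) ∧ G.Adj (f y) z := by
    intro y
    by_cases h : bad y
    · obtain ⟨hy, h1, h2⟩ := (hbad y).1 h
      obtain ⟨z, h3, h4, h5⟩ := hbypass y ((hK y).1 hy).1 ((hK y).1 hy).2 h1 h2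
      exact ⟨z, fun _ => ⟨(hK z).2 ⟨h3, h4⟩, h5⟩⟩
    · exact ⟨y, fun h' => (h h').elim⟩
  choose J hJ using hJ
  have hKN : ∀ a, G.Adj v a → ¬ K a := fun a ha h => ((hK a).1 h).2 ha
  have hKv : ¬ K v := fun h => ((hK v).1 h).1 rfl
  have hbadK : ∀ y, bad y → K y := fun y h => ((hbad y).1 h).1
  have hbadN : ∀ a, G.Adj v a → ¬ bad a := fun a ha h => hKN a ha (hbadK a h)
  have hadjK : ∀ a b, K a → K b → a ≠ b → G.Adj a b := fun a b ha hb =>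
    hα.adj_of_not_adj ((hK a).1 ha).1 ((hK b).1 hb).1 ((hK a).1 ha).2 ((hK b).1 hb).2
  have hfK : ∀ a, K a → G.Adj v (f a) := by
    intro a ha
    by_contra h
    obtain ⟨h1, h2⟩ := (hK a).1 ha
    have h3 : f a ≠ a := fun h => h1 ((hv a).1 h)
    have h4 : f a ≠ v := fun h => h1 (by rw [← hinv a, h, hvv])
    exact hf.not_adj a (hα.adj_of_not_adj h1 h4 h2 h h3.symm)
  -- Two bad vertices that choose each other would both claim the edge between them. They swap
  -- instead: each serves as the middle vertex of a path of length two for the other.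
  obtain ⟨τ, hτ⟩ : ∃ τ : V → V, ∀ y, τ y = if bad y ∧ bad (J y) ∧ J (J y) = y then J y else y :=
    ⟨_, fun _ => rfl⟩
  obtain ⟨m, hm⟩ : ∃ m : V → V → Prop, ∀ a b, m a b ↔ bad a ∧ J a = b ∧ τ a = a :=
    ⟨_, fun _ _ => Iff.rfl⟩
  obtain ⟨ρ, hρ⟩ : ∃ ρ : V → V, ∀ a, ρ a = if K a then f a else if a = f p then p else a :=
    ⟨_, fun _ => rfl⟩
  -- In order of priority: edges from `p` to non-neighbours of `v`, edges from `y` to `J y` without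
  -- a swap, edges from `J y` to `f y`. All others serve the pair of their identified ends.
  obtain ⟨l, hl⟩ : ∃ l : V → V → Sym2 V, ∀ a b, l a b =
      if a = p ∧ K b then s(p, f (τ b)) else if b = p ∧ K a then s(p, f (τ a)) else
      if m a b then s(p, f a) else if m b a then s(p, f b) else
      if bad (f b) ∧ J (f b) = a then s(p, b) else
      if bad (f a) ∧ J (f a) = b then s(p, a) else s(ρ a, ρ b) := ⟨_, fun _ _ => rfl⟩
  have hKp := hKN p hp
  have hKq := hKN _ hq
  have hpq : p ≠ f p := fun h => hp.ne ((hv p).1 h.symm).symm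
  have hxK : ∀ x, G.Adj v x → x ≠ p → x ≠ f p → K (f x) := by
    intro x hx h1 h2
    refine (hK _).2 ⟨fun h => hx.ne (by rw [← hinv x, h, hvv]), fun h => ?_⟩
    rcases hN x hx h with h | h
    · exact h1 h
    · exact h2 h
  have hbase : ∀ a b c d, G.Adj a b → ¬ (a = p ∧ K b) → ¬ (b = p ∧ K a) → ¬ m a b → ¬ m b a →
      ¬ (bad (f b) ∧ J (f b) = a) → ¬ (bad (f a) ∧ J (f a) = b) → ρ a = c → ρ b = d →
      (labelGraph G l s(c, d)).Adj a b := by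
    intro a b c d hab h1 h2 h3 h4 h5 h6 hc hd
    refine ⟨hab, ?_, ?_⟩
    · rw [hl, if_neg h1, if_neg h2, if_neg h3, if_neg h4, if_neg h5, if_neg h6, hc, hd]
    · rw [hl, if_neg h2, if_neg h1, if_neg h4, if_neg h3, if_neg h6, if_neg h5, hc, hd,
        Sym2.eq_swap]
  have hmv : ∀ a, ¬ m v a := fun a h => hKv (hbadK _ ((hm _ _).1 h).1)
  have hmN : ∀ a b, G.Adj v a → ¬ m a b := fun a b ha h => hbadN a ha ((hm _ _).1 h).1
  have hmN' : ∀ a b, G.Adj v a → ¬ m b a := fun a b ha h => by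
    obtain ⟨h1, h2, -⟩ := (hm _ _).1 h
    exact hKN a ha (h2 ▸ (hJ b h1).1)
  have hmv' : ∀ a, ¬ m a v := fun a h => by
    obtain ⟨h1, h2, -⟩ := (hm _ _).1 h
    exact hKv (h2 ▸ (hJ a h1).1)
  have hJN : ∀ a b, G.Adj v a → ¬ (bad b ∧ J b = a) := fun a b ha ⟨h1, h2⟩ =>
    hKN a ha (h2 ▸ (hJ b h1).1)
  have hbv : ¬ bad v := fun h => hKv (hbadK _ h)
  have hρN : ∀ a, G.Adj v a → a ≠ f p → ρ a = a := fun a ha h => by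
    rw [hρ, if_neg (hKN a ha), if_neg h]
  have hρK : ∀ a, K a → ρ a = f a := fun a ha => by rw [hρ, if_pos ha]
  have hρq : ρ (f p) = p := by rw [hρ, if_neg hKq, if_pos rfl]
  have hρv : ρ v = v := by rw [hρ, if_neg hKv, if_neg hq.ne]
  have hvx : ∀ x, G.Adj v x → x ≠ f p → (labelGraph G l s(v, x)).Reachable v x := by
    intro x hx hxq
    refine (hbase v x v x hx ?_ ?_ (hmv x) (hmv' x) ?_ ?_ hρv (hρN x hx hxq)).reachable
    · exact fun h => hp.ne h.1
    · exact fun h => hKv h.2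
    · exact fun h => hKv (h.2 ▸ (hJ _ h.1).1)
    · exact fun h => hbv (hvv ▸ h.1)
  have hxx : ∀ x x', G.Adj v x → x ≠ p → x ≠ f p → G.Adj v x' → x' ≠ p → x' ≠ f p → x ≠ x' →
      (labelGraph G l s(x, x')).Reachable x x' := by
    intro x x' hx hxp hxq hx' hxp' hxq' hne
    have hy := hxK x hx hxp hxq
    have hy' := hxK x' hx' hxp' hxq'
    by_cases hadj : G.Adj x x'
    · exact (hbase x x' x x' hadj (fun h => hxp h.1) (fun h => hxp' h.1) (hmN _ _ hx)
        (hmN _ _ hx') (hJN _ _ hx) (hJN _ _ hx') (hρN x hx hxq) (hρN x' hx' hxq')).reachable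
    · have hnx : ¬ G.Adj x' x := fun h => hadj h.symm
      have hfx : f x ≠ x := fun h => hx.ne ((hv x).1 h).symm
      have hfx' : f x' ≠ x' := fun h => hx'.ne ((hv x').1 h).symm
      have a1 := hα.adj_pairing hf hfx' hadj hne fun h => hKN x hx (h ▸ hy')
      have a2 := hα.adj_pairing hf hfx hnx hne.symm fun h => hKN x' hx' (h ▸ hy)
      have a3 := hadjK _ _ hy' hy fun h => hne (by rw [← hinv x, ← hinv x', h])
      have hρy : ρ (f x) = x := by rw [hρK _ hy, hinv]
      have hρy' : ρ (f x') = x' := by rw [hρK _ hy', hinv]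
      have hyp : f x ≠ p := fun h => hKp (h ▸ hy)
      have hyp' : f x' ≠ p := fun h => hKp (h ▸ hy')
      -- A bypass uses only edges whose pair is directly adjacent, so it cannot meet the chain of
      -- the non-adjacent `x`, `x'`.
      have hno : ¬ (bad (f x) ∧ J (f x) = f x') := fun ⟨h1, h2⟩ => by
        have := (hJ _ h1).2.2.1
        rw [h2, hinv, hinv] at this
        exact hadj this
      have hno' : ¬ (bad (f x') ∧ J (f x') = f x) := fun ⟨h1, h2⟩ => by
        have := (hJ _ h1).2.2.1
        rw [h2, hinv, hinv] at this
        exact hnx this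
      have hbx : ¬ bad (f (f x)) := by rw [hinv]; exact hbadN x hx
      have hbx' : ¬ bad (f (f x')) := by rw [hinv]; exact hbadN x' hx'
      have e1 := hbase x (f x') x x' a1 (fun h => hxp h.1) (fun h => hyp' h.1) (hmN _ _ hx)
        (hmN' _ _ hx) (fun h => hbx' h.1) hno (hρN x hx hxq) hρy'
      have e2 := hbase (f x') (f x) x' x a3 (fun h => hyp' h.1) (fun h => hyp h.1)
        (fun h => hno' ⟨((hm _ _).1 h).1, ((hm _ _).1 h).2.1⟩)
        (fun h => hno ⟨((hm _ _).1 h).1, ((hm _ _).1 h).2.1⟩)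
        (fun h => hbx h.1) (fun h => hbx' h.1) hρy' hρy
      have e3 := hbase (f x) x' x x' a2.symm (fun h => hyp h.1) (fun h => hxp' h.1)
        (hmN' _ _ hx') (hmN _ _ hx') hno' (fun h => hbx h.1) hρy (hρN x' hx' hxq')
      rw [Sym2.eq_swap] at e2
      exact e1.reachable.trans (e2.reachable.trans e3.reachable)
  have hpx : ∀ x, G.Adj v x → x ≠ p → x ≠ f p → (labelGraph G l s(p, x)).Reachable p x := by
    intro x hx hxp hxq
    have hy := hxK x hx hxp hxq
    by_cases hadj : G.Adj p x
    · exact (hbase p x p x hadj (fun h => hKN x hx h.2) (fun h => hxp h.1) (hmN _ _ hp)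
        (hmN _ _ hx) (hJN _ _ hp) (hJN _ _ hx) (hρN p hp hpq) (hρN x hx hxq)).reachable
    obtain ⟨y, hyx⟩ : ∃ y, y = f x := ⟨_, rfl⟩
    have hxy : f y = x := by rw [hyx, hinv]
    rw [← hyx] at hy
    have hpadj : ∀ y, K y → ¬ G.Adj p (f y) → f y ≠ p → G.Adj p y := by
      intro y hy h hne
      have h1 : f (f y) ≠ f y := fun h => ((hK y).1 hy).1 ((hv y).1 (by
        rw [hinv] at h; exact h.symm))
      have := hα.adj_pairing hf h1 h hne.symm (fun h => hKp (by rw [h, hinv]; exact hy))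
      rwa [hinv] at this
    have hpl : ∀ z, K z → G.Adj p z → (labelGraph G l s(p, f (τ z))).Adj p z := by
      intro z hz h
      refine ⟨h, ?_, ?_⟩
      · rw [hl, if_pos ⟨rfl, hz⟩]
      · rw [hl, if_neg fun h => hKp h.2, if_pos ⟨rfl, hz⟩]
    by_cases hb : bad y
    · obtain ⟨h1, h2, h3, h4⟩ := hJ y hb
      have e : (labelGraph G l s(p, x)).Adj (J y) x := by
        rw [hxy] at h4
        have hJp : J y ≠ p := fun h => hKp (h ▸ h1)
        have hbJ : ¬ bad (f (J y)) := hbadN _ (hfK _ h1)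
        refine ⟨h4.symm, ?_, ?_⟩
        · rw [hl, if_neg fun h => hJp h.1, if_neg fun h => hxp h.1, if_neg (hmN' _ _ hx),
            if_neg (hmN _ _ hx), if_pos]
          rw [← hyx]
          exact ⟨hb, rfl⟩
        · rw [hl, if_neg fun h => hxp h.1, if_neg fun h => hJp h.1, if_neg (hmN _ _ hx),
            if_neg (hmN' _ _ hx), if_neg fun h => hbJ h.1, if_pos]
          rw [← hyx]
          exact ⟨hb, rfl⟩
      -- After a swap the path is `p, J y, x`; otherwise it is `p, y, J y, x`.
      by_cases hc : bad y ∧ bad (J y) ∧ J (J y) = y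
      · have hτJ : τ (J y) = y := by
          rw [hτ, if_pos ⟨hc.2.1, by rw [hc.2.2]; exact hb, by rw [hc.2.2]⟩, hc.2.2]
        have hfJ : f (J y) ≠ p := fun h => hKq (by rw [← h, hinv]; exact h1)
        have e1 := hpl (J y) h1 (hpadj _ h1 ((hbad _).1 hc.2.1).2.1 hfJ)
        rw [hτJ, hxy] at e1
        exact e1.reachable.trans e.reachable
      · have hτy : τ y = y := by rw [hτ, if_neg hc]
        have e1 := hpl y hy (hpadj y hy (by rwa [hxy]) (by rwa [hxy]))
        rw [hτy, hxy] at e1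
        have hmy : m y (J y) := (hm _ _).2 ⟨hb, rfl, hτy⟩
        have hmy' : ¬ m (J y) y := fun h => hc ⟨hb, ((hm _ _).1 h).1, ((hm _ _).1 h).2.1⟩
        have hJp : J y ≠ p := fun h => hKp (h ▸ h1)
        have hyp : y ≠ p := fun h => hKp (h ▸ hy)
        have e2 : (labelGraph G l s(p, x)).Adj y (J y) := by
          refine ⟨hadjK _ _ hy h1 h2.symm, ?_, ?_⟩
          · rw [hl, if_neg fun h => hyp h.1, if_neg fun h => hJp h.1, if_pos hmy, hxy]
          · rw [hl, if_neg fun h => hJp h.1, if_neg fun h => hyp h.1, if_neg hmy', if_pos hmy,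
              hxy]
        exact e1.reachable.trans (e2.reachable.trans e.reachable)
    · have hτy : τ y = y := by rw [hτ, if_neg fun h => hb h.1]
      have e1 := hpl y hy (hpadj y hy (by rwa [hxy]) (by rwa [hxy]))
      rw [hτy, hxy] at e1
      have hqy : G.Adj (f p) y := by
        by_contra h
        exact hb ((hbad y).2 ⟨hy, by rwa [hxy], h⟩)
      have hfp : f p ≠ p := hpq.symm
      have hqx : G.Adj x (f p) := hα.adj_pairing hf hfp (fun h => hadj h.symm) hxp hxq
      have hyp : y ≠ p := fun h => hKp (h ▸ hy)
      have hbx : ¬ bad (f y) := by rw [hxy]; exact hbadN x hx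
      have hbq : ¬ bad (f (f p)) := by rw [hinv]; exact hbadN p hp
      have e2 := hbase y (f p) x p hqy.symm (fun h => hyp h.1) (fun h => hfp h.1)
        (hmN' _ _ hq) (hmN _ _ hq) (fun h => hbq h.1) (fun h => hbx h.1)
        (by rw [hρK y hy, hxy]) hρq
      have e3 := hbase (f p) x p x hqx.symm (fun h => hfp h.1) (fun h => hxp h.1)
        (hmN _ _ hq) (hmN _ _ hx) (fun h => hb (hyx ▸ h.1)) (fun h => hbq h.1) hρq
        (hρN x hx hxq)
      rw [Sym2.eq_swap] at e2
      exact e1.reachable.trans (e2.reachable.trans e3.reachable)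
  refine ⟨insert v ((G.neighborFinset v).erase (f p)), ?_, l, ?_⟩
  · rw [Finset.card_insert_of_notMem (by simp), Finset.card_erase_of_mem (by simpa using hq),
      card_neighborFinset_eq_degree]
    have : 0 < G.degree v := (G.degree_pos_iff_exists_adj v).2 ⟨p, hp⟩
    omega
  have hsymm : ∀ {a b}, (labelGraph G l s(a, b)).Reachable a b →
      (labelGraph G l s(b, a)).Reachable b a := fun h => by rw [Sym2.eq_swap]; exact h.symm
  intro a ha b hb hab
  simp only [Finset.mem_insert, Finset.mem_erase, mem_neighborFinset] at ha hb
  rcases ha with rfl | ⟨haq, ha⟩ <;> rcases hb with rfl | ⟨hbq, hb⟩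
  · exact (hab rfl).elim
  · exact hvx b hb hbq
  · exact hsymm (hvx a ha haq)
  · by_cases hap : a = p
    · subst hap
      exact hpx b hb hab.symm hbq
    by_cases hbp : b = p
    · subst hbp
      exact hsymm (hpx a ha hab haq)
    exact hxx a b ha hap haq hb hbp hbq hab

end Kempe

/-! ### Degrees and common neighbours -/

theorem IsPairing.adj_of_not_adj {V : Type*} {G : SimpleGraph V} (hα : HasNoIndepTriple G) {f : V → V} {v : V}
    (hf : IsPairing Gᶜ f) (hv : ∀ a, f a = a ↔ a = v) {a : V} (ha : a ≠ v) (hva : ¬ G.Adj v a) :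
    G.Adj v (f a) := by
  by_contra h
  have h3 : f a ≠ a := fun h => ha ((hv a).1 h)
  have h4 : f a ≠ v := fun h => ha (by rw [← hf.invol a, h, (hv v).2 rfl])
  exact hf.not_adj a (hα.adj_of_not_adj ha h4 hva h h3.symm)

theorem HasNoIndepTriple.adj_or_adj {V : Type*} {G : SimpleGraph V} (hα : HasNoIndepTriple G) {x y a : V} (hxy : x ≠ y)
    (hn : ¬ G.Adj x y) (hax : a ≠ x) (hay : a ≠ y) : G.Adj x a ∨ G.Adj y a := by
  rcases hα x y a hxy hax.symm hay.symm with h | h | h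
  · exact (hn h).elim
  · exact Or.inl h
  · exact Or.inr h

section Degrees

variable {V : Type*} [Fintype V] [DecidableEq V] {G : SimpleGraph V} [DecidableRel G.Adj] {t : ℕ}

theorem mem_neighborFinset_compl {v a : V} :
    a ∈ Gᶜ.neighborFinset v ↔ a ≠ v ∧ ¬ G.Adj v a := by
  rw [mem_neighborFinset, compl_adj, ne_comm]

theorem degree_compl_add_degree (G : SimpleGraph V) [DecidableRel G.Adj] (v : V) :
    Gᶜ.degree v + G.degree v + 1 = Fintype.card V := by
  have := G.degree_compl (v := v)
  have := G.degree_lt_card_verts v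
  omega

theorem HasNoIndepTriple.isClique_neighborFinset_compl (hα : HasNoIndepTriple G) (v : V) :
    G.IsClique (Gᶜ.neighborFinset v : Set V) := by
  intro a ha b hb hab
  rw [Finset.mem_coe, mem_neighborFinset_compl] at ha hb
  exact hα.adj_of_not_adj ha.1 hb.1 ha.2 hb.2 hab

/-- The non-neighbours of `v` form a clique, so there are fewer than `t` of them and the degree is
at least `t - 1`. In case of equality the matching maps them onto the neighbours, and the chains
yield `K_t`. -/
theorem HasNearPairings.le_degree (hα : HasNoIndepTriple G) (hG : HasNearPairings G)
    (hn : Fintype.card V + 1 = 2 * t) (hno : ¬ HasCliqueImmersion G t) (v : V) :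
    t ≤ G.degree v := by
  have hsum := degree_compl_add_degree G v
  have h1 : Gᶜ.degree v < t := by
    by_contra! h
    exact hno ((HasCliqueImmersion.of_isClique (hα.isClique_neighborFinset_compl v)).le
      (by rwa [card_neighborFinset_eq_degree]))
  by_contra! hlt
  obtain ⟨f, hf, hv⟩ := hG v
  refine hno ((HasCliqueImmersion.of_pairing_neighbors hα hf hv fun a ha hfa => ?_).le
    (by omega : t ≤ G.degree v + 1))
  have hinj : Function.Injective f := fun a b h => by rw [← hf.invol a, ← hf.invol b, h]
  have hsub : (Gᶜ.neighborFinset v).image f ⊆ G.neighborFinset v := by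
    intro b hb
    obtain ⟨c, hc, rfl⟩ := Finset.mem_image.1 hb
    rw [mem_neighborFinset_compl] at hc
    rw [mem_neighborFinset]
    exact hf.adj_of_not_adj hα hv hc.1 hc.2
  have heq := Finset.eq_of_subset_of_card_le hsub (by
    rw [Finset.card_image_of_injective _ hinj, card_neighborFinset_eq_degree,
      card_neighborFinset_eq_degree]
    omega)
  have hmem : a ∈ (Gᶜ.neighborFinset v).image f := by
    rw [heq]
    simpa using ha
  obtain ⟨c, hc, rfl⟩ := Finset.mem_image.1 hmem
  rw [mem_neighborFinset_compl] at hc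
  rw [hf.invol] at hfa
  exact hc.2 hfa

/-- A vertex of degree `t` has `t - 2` non-neighbours, so exactly two neighbours `p`, `f p` are
matched to each other. The bypasses exist because all degrees are at least `t`. -/
theorem HasNearPairings.lt_degree (hα : HasNoIndepTriple G) (hG : HasNearPairings G)
    (hn : Fintype.card V + 1 = 2 * t) (hno : ¬ HasCliqueImmersion G t) (v : V) :
    t < G.degree v := by
  have hle := hG.le_degree hα hn hno
  refine lt_of_le_of_ne (hle v) fun hdeg => ?_
  have hsum := degree_compl_add_degree G v
  obtain ⟨f, hf, hv⟩ := hG v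
  have hinv := hf.invol
  have hinj : Function.Injective f := fun a b h => by rw [← hinv a, ← hinv b, h]
  obtain ⟨K, hK⟩ : ∃ K, K = Gᶜ.neighborFinset v := ⟨_, rfl⟩
  have hKc : K.card + 2 = t := by
    rw [hK, card_neighborFinset_eq_degree]
    omega
  have hKm : ∀ a, a ∈ K ↔ a ≠ v ∧ ¬ G.Adj v a := fun a => by rw [hK, mem_neighborFinset_compl]
  have hfK : ∀ a ∈ K, G.Adj v (f a) := fun a ha =>
    hf.adj_of_not_adj hα hv ((hKm a).1 ha).1 ((hKm a).1 ha).2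
  have hsub : K.image f ⊆ G.neighborFinset v := by
    intro b hb
    obtain ⟨c, hc, rfl⟩ := Finset.mem_image.1 hb
    simpa using hfK c hc
  obtain ⟨D, hD⟩ : ∃ D, D = G.neighborFinset v \ K.image f := ⟨_, rfl⟩
  have hDc : D.card = 2 := by
    rw [hD, Finset.card_sdiff_of_subset hsub, Finset.card_image_of_injective _ hinj,
      card_neighborFinset_eq_degree]
    omega
  have hDm : ∀ a, a ∈ D ↔ G.Adj v a ∧ G.Adj v (f a) := by
    intro a
    rw [hD, Finset.mem_sdiff, mem_neighborFinset, Finset.mem_image]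
    refine and_congr_right fun ha => ⟨fun h => ?_, ?_⟩
    · by_contra h'
      refine h ⟨f a, (hKm _).2 ⟨fun h'' => ha.ne ?_, h'⟩, hinv a⟩
      rw [← hinv a, h'', (hv v).2 rfl]
    · rintro h ⟨c, hc, rfl⟩
      rw [hinv] at h
      exact ((hKm c).1 hc).2 h
  obtain ⟨p, hpD⟩ : D.Nonempty := Finset.card_pos.1 (by omega)
  obtain ⟨hp, hq⟩ := (hDm p).1 hpD
  have hpq : p ≠ f p := fun h => hp.ne ((hv p).1 h.symm).symm
  have hDeq : ({p, f p} : Finset V) = D := by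
    refine Finset.eq_of_subset_of_card_le ?_ (by rw [Finset.card_pair hpq, hDc])
    intro a ha
    rw [hDm]
    rcases Finset.mem_insert.1 ha with rfl | ha
    · exact ⟨hp, hq⟩
    · rw [Finset.mem_singleton.1 ha, hinv]
      exact ⟨hq, hp⟩
  have hN : ∀ a, G.Adj v a → G.Adj v (f a) → a = p ∨ a = f p := by
    intro a h1 h2
    have := (hDm a).2 ⟨h1, h2⟩
    rw [← hDeq] at this
    simpa using this
  rw [hdeg] at hno
  refine hno (HasCliqueImmersion.of_pairing_neighbors_except hα hf hv hp hq hN ?_)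
  intro y hyv hvy hpy hqy
  by_contra! hz
  have hyK : y ∈ K := (hKm y).2 ⟨hyv, hvy⟩
  -- Without a bypass, `f y` sees at most one of `z`, `f z` for each `z ≠ y` in `K`. Its neighbours
  -- other than `v` and `f p` then inject into `K.erase y`, so its degree is at most `(t - 3) + 2`.
  let π : V → V := fun a => if a ∈ K then a else f a
  have hπ : ((G.neighborFinset (f y) \ {v, f p}).image π).card =
      (G.neighborFinset (f y) \ {v, f p}).card := by
    refine Finset.card_image_of_injOn ?_
    intro a ha b hb hab
    simp only [Finset.coe_sdiff, coe_neighborFinset, Set.mem_sdiff, mem_neighborSet] at ha hb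
    have hx : ∀ a ∈ K, G.Adj (f y) a → G.Adj (f y) (f a) → False := by
      intro a ha h1 h2
      refine hz a ((hKm a).1 ha).1 ((hKm a).1 ha).2 ?_ h2 h1
      rintro rfl
      exact h2.ne rfl
    by_cases haK : a ∈ K <;> by_cases hbK : b ∈ K
    · simpa [π, haK, hbK] using hab
    · simp only [π, haK, hbK, if_true, if_false] at hab
      exact (hx a haK ha.1 (by rw [hab, hinv]; exact hb.1)).elim
    · simp only [π, haK, hbK, if_true, if_false] at hab
      exact (hx b hbK hb.1 (by rw [← hab, hinv]; exact ha.1)).elim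
    · simp only [π, haK, hbK, if_false] at hab
      exact hinj hab
  have hsub : (G.neighborFinset (f y) \ {v, f p}).image π ⊆ K.erase y := by
    intro b hb
    obtain ⟨a, ha, rfl⟩ := Finset.mem_image.1 hb
    simp only [Finset.mem_sdiff, mem_neighborFinset, Finset.mem_insert, Finset.mem_singleton,
      not_or] at ha
    obtain ⟨hadj, hav, haq⟩ := ha
    by_cases haK : a ∈ K
    · simp only [π, haK, if_true, Finset.mem_erase, and_true]
      rintro rfl
      exact hf.not_adj a hadj.symm
    · simp only [π, haK, if_false, Finset.mem_erase]
      have hva : G.Adj v a := by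
        by_contra h
        exact haK ((hKm a).2 ⟨hav, h⟩)
      refine ⟨?_, (hKm _).2 ⟨fun h => hav ?_, fun h => ?_⟩⟩
      · rintro rfl
        rw [hinv] at hadj
        exact hadj.ne rfl
      · rw [← hinv a, h, (hv v).2 rfl]
      · rcases hN a hva h with rfl | h
        · exact hpy hadj.symm
        · exact haq h
  have h1 := Finset.card_le_card hsub
  rw [hπ, Finset.card_erase_of_mem hyK] at h1
  have h2 := Finset.le_card_sdiff {v, f p} (G.neighborFinset (f y))
  rw [card_neighborFinset_eq_degree] at h2
  have h3 := Finset.card_le_two (a := v) (b := f p)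
  have h4 := hle (f y)
  have h5 : 0 < K.card := Finset.card_pos.2 ⟨y, hyK⟩
  omega

/-- Two non-adjacent vertices dominate all others; inclusion–exclusion does the rest. -/
theorem HasNoIndepTriple.degree_add_degree (hα : HasNoIndepTriple G) {x y : V} (hxy : x ≠ y)
    (hn : ¬ G.Adj x y) :
    G.degree x + G.degree y + 2 =
      Fintype.card V + (G.neighborFinset x ∩ G.neighborFinset y).card := by
  have h1 := Finset.card_union_add_card_inter (G.neighborFinset x) (G.neighborFinset y)
  have h2 : G.neighborFinset x ∪ G.neighborFinset y = ({x, y} : Finset V)ᶜ := by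
    ext a
    simp only [Finset.mem_union, mem_neighborFinset, Finset.mem_compl, Finset.mem_insert,
      Finset.mem_singleton, not_or]
    refine ⟨?_, fun h => hα.adj_or_adj hxy hn h.1 h.2⟩
    rintro (h | h)
    · exact ⟨h.ne', fun h' => hn (h' ▸ h)⟩
    · exact ⟨fun h' => hn (h' ▸ h.symm), h.ne'⟩
  have h3 := Finset.card_add_card_compl ({x, y} : Finset V)
  rw [← h2, Finset.card_pair hxy] at h3
  rw [card_neighborFinset_eq_degree, card_neighborFinset_eq_degree] at h1
  omega

/-- Non-adjacent vertices with many common neighbours allow a clique immersion in `G - x - y` to be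
extended. -/
theorem HasNoIndepTriple.card_inter_add_lt (hα : HasNoIndepTriple G) {k : ℕ}
    (hno : ¬ HasCliqueImmersion G (k + 1)) {x y : V} (hxy : x ≠ y) (hn : ¬ G.Adj x y)
    (hi : HasCliqueImmersion (G.induce {w | w ≠ x ∧ w ≠ y}) k) :
    (G.neighborFinset x ∩ G.neighborFinset y).card + 2 ≤ k := by
  obtain ⟨B, rfl, hB, l, hl⟩ := hi.exists_of_induce
  have hxB : x ∉ B := fun h => (hB x h).1 rfl
  have hyB : y ∉ B := fun h => (hB y h).2 rfl
  obtain ⟨C, hC⟩ : ∃ C, C = G.neighborFinset x ∩ G.neighborFinset y := ⟨_, rfl⟩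
  have hCm : ∀ a, a ∈ C ↔ G.Adj x a ∧ G.Adj y a := fun a => by simp [hC]
  have h1 : (C \ B).card < (B.filter fun b => ¬ G.Adj x b).card := by
    by_contra! h
    refine hno (HasCliqueImmersion.insert_of_not_adj (x := x) (y := y) (D := C \ B)
      (fun a b hab => ?_) hl hxB hyB (fun b hb h => ?_) (fun c hc => ?_)
      (fun b hb h => Finset.mem_filter.2 ⟨hb, h⟩) h)
    · obtain ⟨ha, hb, h⟩ := map_induce_adj.1 hab
      exact ⟨h, ha.1, ha.2, hb.1, hb.2⟩
    · exact (hα.adj_or_adj hxy hn (hB b hb).1 (hB b hb).2).resolve_left h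
    · obtain ⟨hc, hcB⟩ := Finset.mem_sdiff.1 hc
      exact ⟨((hCm c).1 hc).1, ((hCm c).1 hc).2, hcB⟩
  have h2 : (C \ B).card < (B.filter fun b => ¬ G.Adj y b).card := by
    by_contra! h
    refine hno (HasCliqueImmersion.insert_of_not_adj (x := y) (y := x) (D := C \ B)
      (fun a b hab => ?_) hl hyB hxB (fun b hb h => ?_) (fun c hc => ?_)
      (fun b hb h => Finset.mem_filter.2 ⟨hb, h⟩) h)
    · obtain ⟨ha, hb, h⟩ := map_induce_adj.1 hab
      exact ⟨h, ha.2, ha.1, hb.2, hb.1⟩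
    · exact (hα.adj_or_adj hxy hn (hB b hb).1 (hB b hb).2).resolve_right h
    · obtain ⟨hc, hcB⟩ := Finset.mem_sdiff.1 hc
      exact ⟨((hCm c).1 hc).2, ((hCm c).1 hc).1, hcB⟩
  -- No branch vertex misses both `x` and `y`. So `B` contains, disjointly, `C ∩ B` and the two sets
  -- of missed vertices, each larger than `C \ B`.
  have hd1 : Disjoint (B.filter fun b => ¬ G.Adj x b) (B.filter fun b => ¬ G.Adj y b) := by
    rw [Finset.disjoint_filter]
    intro b hb h h'
    rcases hα.adj_or_adj hxy hn (hB b hb).1 (hB b hb).2 with h'' | h''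
    · exact h h''
    · exact h' h''
  have hd2 : Disjoint ((B.filter fun b => ¬ G.Adj x b) ∪ B.filter fun b => ¬ G.Adj y b)
      (C ∩ B) := by
    rw [Finset.disjoint_left]
    intro b hb hb'
    have := (hCm b).1 (Finset.mem_inter.1 hb').1
    simp [this] at hb
  have h3 : ((B.filter fun b => ¬ G.Adj x b) ∪ B.filter fun b => ¬ G.Adj y b) ∪ (C ∩ B) ⊆ B := by
    intro b hb
    simp only [Finset.mem_union, Finset.mem_filter, Finset.mem_inter] at hb
    tauto
  have h4 := Finset.card_le_card h3
  rw [Finset.card_union_of_disjoint hd2, Finset.card_union_of_disjoint hd1] at h4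
  have h5 := Finset.card_sdiff_add_card_inter C B
  rw [← hC]
  omega

end Degrees

/-! ### Dirac's theorem by optimal cyclic arrangements -/

section Dirac

variable {V : Type*} (G : SimpleGraph V) [DecidableRel G.Adj]

/-- The number of pairs of consecutive entries of a list that are adjacent in `G`. -/
def adjCount : List V → ℕ
  | a :: b :: l => (if G.Adj a b then 1 else 0) + adjCount (b :: l)
  | _ => 0

theorem adjCount_append_cons (l₁ l₂ : List V) (a : V) :
    adjCount G (l₁ ++ a :: l₂) = adjCount G (l₁ ++ [a]) + adjCount G (a :: l₂) := by
  induction l₁ with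
  | nil => simp [adjCount]
  | cons b l₁ ih =>
    cases l₁ with
    | nil => simp [adjCount]
    | cons c l₁ =>
      simp only [List.cons_append, adjCount] at ih ⊢
      rw [ih, add_assoc]

theorem adjCount_reverse (l : List V) : adjCount G l.reverse = adjCount G l := by
  induction l with
  | nil => rfl
  | cons a l ih =>
    cases l with
    | nil => rfl
    | cons b l =>
      rw [List.reverse_cons, List.reverse_cons, List.append_assoc, List.singleton_append,
        adjCount_append_cons, ← List.reverse_cons, ih]
      simp [adjCount, G.adj_comm, add_comm]

/-- The number of adjacent consecutive pairs of a cyclically arranged list. -/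
def cyclicAdjCount : List V → ℕ
  | a :: l => adjCount G (a :: (l ++ [a]))
  | [] => 0

theorem cyclicAdjCount_rotate_cons (a : V) (l : List V) :
    cyclicAdjCount G (l ++ [a]) = cyclicAdjCount G (a :: l) := by
  cases l with
  | nil => rfl
  | cons b l =>
    simp only [cyclicAdjCount, List.cons_append, List.append_assoc, List.nil_append]
    have := adjCount_append_cons G (b :: l) [b] a
    simp only [List.cons_append] at this
    rw [this]
    simp [adjCount, add_comm]

theorem cyclicAdjCount_append_comm (l₁ l₂ : List V) :
    cyclicAdjCount G (l₁ ++ l₂) = cyclicAdjCount G (l₂ ++ l₁) := by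
  induction l₁ generalizing l₂ with
  | nil => simp
  | cons a l₁ ih =>
    rw [List.cons_append, ← cyclicAdjCount_rotate_cons, List.append_assoc, ih, List.append_assoc,
      List.singleton_append]

/-- A cyclic arrangement of all vertices with the most adjacent consecutive pairs. -/
structure IsBestArrangement (L : List V) : Prop where
  nodup : L.Nodup
  mem : ∀ a, a ∈ L
  le : ∀ L' : List V, L'.Perm L → cyclicAdjCount G L' ≤ cyclicAdjCount G L

theorem IsBestArrangement.append_comm {G : SimpleGraph V} [DecidableRel G.Adj] {l₁ l₂ : List V} (h : IsBestArrangement G (l₁ ++ l₂)) :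
    IsBestArrangement G (l₂ ++ l₁) := by
  have hp : (l₂ ++ l₁).Perm (l₁ ++ l₂) := List.perm_append_comm
  refine ⟨hp.nodup_iff.2 h.nodup, fun a => hp.mem_iff.2 (h.mem a), fun L' hL' => ?_⟩
  rw [cyclicAdjCount_append_comm G l₂]
  exact h.le L' (hL'.trans hp)

variable [Fintype V] [DecidableEq V]

theorem exists_isBestArrangement : ∃ L, IsBestArrangement G L := by
  obtain ⟨L, hL, hmax⟩ := (Finset.univ : Finset V).toList.permutations.toFinset.exists_max_image
    (cyclicAdjCount G) ⟨Finset.univ.toList, by simp⟩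
  rw [List.mem_toFinset, List.mem_permutations] at hL
  refine ⟨L, hL.nodup_iff.2 (Finset.nodup_toList _), fun a => hL.mem_iff.2 (by simp), ?_⟩
  intro L' hL'
  exact hmax L' (by rw [List.mem_toFinset, List.mem_permutations]; exact hL'.trans hL)

variable {G}

/-- If `a`, `b` are not adjacent, some `p` adjacent to `a` has its successor adjacent to `b`.
Reversing the segment from `b` to `p` then increases the number of adjacent consecutive pairs. -/
theorem IsBestArrangement.adj_head (hdeg : ∀ v, Fintype.card V ≤ 2 * G.degree v) {a b : V}
    {l : List V} (h : IsBestArrangement G (a :: b :: l)) : G.Adj a b := by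
  by_contra hab
  obtain ⟨σ, hσ⟩ : ∃ σ, σ = (a :: b :: l).formPerm := ⟨_, rfl⟩
  have hnext : ∀ l₁ p q l₂, a :: b :: l = l₁ ++ p :: q :: l₂ → σ p = q := by
    intro l₁ p q l₂ he
    have h1 : (l₁ ++ p :: q :: l₂).Nodup := he ▸ h.nodup
    have h2 := List.formPerm_apply_lt_getElem _ h1 l₁.length (by simp)
    rw [hσ, he]
    simpa using h2
  have hlast : ∀ l₁ p, a :: b :: l = l₁ ++ [p] → σ p = a := by
    intro l₁ p he
    have : p = (a :: b :: l).getLast (by simp) := by simp [he]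
    rw [hσ, this, List.formPerm_apply_getLast]
  have hσa : σ a = b := hnext [] a b l rfl
  obtain ⟨p, hp1, hp2⟩ : ∃ p, G.Adj a p ∧ G.Adj b (σ p) := by
    by_contra! hno
    -- The neighbours of `a` and the predecessors of neighbours of `b` all avoid `a`. If disjoint
    -- they would number at most `n - 1`, against the degree condition.
    have hdisj : Disjoint (G.neighborFinset a)
        ((G.neighborFinset b).map σ.symm.toEmbedding) := by
      rw [Finset.disjoint_left]
      intro p hp hp'
      obtain ⟨q, hq, rfl⟩ := Finset.mem_map.1 hp'
      refine hno _ ((mem_neighborFinset ..).1 hp) ?_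
      simpa using hq
    have hsub : G.neighborFinset a ∪ (G.neighborFinset b).map σ.symm.toEmbedding ⊆
        Finset.univ.erase a := by
      intro p hp
      rw [Finset.mem_erase]
      refine ⟨?_, Finset.mem_univ _⟩
      rintro rfl
      rcases Finset.mem_union.1 hp with hp | hp
      · exact ((mem_neighborFinset ..).1 hp).ne rfl
      · obtain ⟨q, hq, hqp⟩ := Finset.mem_map.1 hp
        have : q = b := by rw [← hσa, ← hqp]; simp
        exact ((mem_neighborFinset ..).1 hq).ne this.symm
    have h1 := Finset.card_le_card hsub
    rw [Finset.card_union_of_disjoint hdisj, Finset.card_map,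
      Finset.card_erase_of_mem (Finset.mem_univ _), Finset.card_univ,
      card_neighborFinset_eq_degree, card_neighborFinset_eq_degree] at h1
    have h2 := hdeg a
    have h3 := hdeg b
    have h4 : 0 < Fintype.card V := Fintype.card_pos_iff.2 ⟨a⟩
    omega
  have hpl : p ∈ l := by
    have := h.mem p
    simp only [List.mem_cons] at this
    rcases this with rfl | rfl | h
    · exact (hp1.ne rfl).elim
    · exact (hab hp1).elim
    · exact h
  obtain ⟨l₁, l₂, rfl⟩ := List.append_of_mem hpl
  cases l₂ with
  | nil =>
    rw [hlast (a :: b :: l₁) p rfl] at hp2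
    exact hab hp2.symm
  | cons q l₂ =>
    rw [hnext (a :: b :: l₁) p q l₂ rfl] at hp2
    have hperm : (a :: ((p :: l₁.reverse) ++ (b :: q :: l₂))).Perm
        (a :: b :: (l₁ ++ p :: q :: l₂)) := by
      have h1 : ((p :: l₁.reverse) ++ (b :: q :: l₂)) = (b :: (l₁ ++ [p])).reverse ++ q :: l₂ := by
        simp
      have h2 : b :: (l₁ ++ p :: q :: l₂) = (b :: (l₁ ++ [p])) ++ q :: l₂ := by simp
      rw [h1, h2]
      exact ((List.reverse_perm _).append_right _).cons a
    refine (h.le _ hperm).not_gt ?_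
    have e1 := adjCount_append_cons G (b :: l₁) (q :: (l₂ ++ [a])) p
    have e2 := adjCount_append_cons G (p :: l₁.reverse) (q :: (l₂ ++ [a])) b
    have e3 := adjCount_reverse G ((b :: l₁) ++ [p])
    have e4 : ((b :: l₁) ++ [p]).reverse = (p :: l₁.reverse) ++ [b] := by simp
    rw [e4] at e3
    simp only [cyclicAdjCount, List.cons_append, List.append_assoc, adjCount, hab, hp1, hp2,
      if_true, if_false] at e1 e2 e3 ⊢
    split_ifs at e1 <;> omega

theorem IsBestArrangement.isChain (hdeg : ∀ v, Fintype.card V ≤ 2 * G.degree v) {L : List V}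
    (h : IsBestArrangement G L) : L.IsChain G.Adj := by
  rw [List.isChain_iff_getElem]
  intro i hi
  have h1 : L = L.take i ++ L[i] :: L[i + 1] :: L.drop (i + 2) := by
    rw [← List.drop_eq_getElem_cons, ← List.drop_eq_getElem_cons, List.take_append_drop]
  rw [h1] at h
  exact IsBestArrangement.adj_head hdeg h.append_comm

theorem exists_isBestArrangement_cons (G : SimpleGraph V) [DecidableRel G.Adj] (v : V) :
    ∃ L, IsBestArrangement G (v :: L) := by
  obtain ⟨L, hL⟩ := exists_isBestArrangement G
  obtain ⟨l₁, l₂, rfl⟩ := List.append_of_mem (hL.mem v)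
  exact ⟨l₂ ++ l₁, hL.append_comm⟩

theorem exists_walk_support_eq {V : Type*} {G : SimpleGraph V} (l : List V) {b z : V}
    (h : (b :: (l ++ [z])).IsChain G.Adj) : ∃ p : G.Walk b z, p.support = b :: (l ++ [z]) := by
  induction l generalizing b with
  | nil =>
    rw [List.nil_append, List.isChain_pair] at h
    exact ⟨h.toWalk, rfl⟩
  | cons c l ih =>
    rw [List.cons_append, List.isChain_cons_cons] at h
    obtain ⟨p, hp⟩ := ih h.2
    exact ⟨Walk.cons h.1 p, by simp [hp]⟩

/-- Dirac's theorem. -/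
theorem exists_isHamiltonianCycle (hcard : 3 ≤ Fintype.card V)
    (hdeg : ∀ v, Fintype.card V ≤ 2 * G.degree v) :
    ∃ (a : V) (p : G.Walk a a), p.IsHamiltonianCycle := by
  obtain ⟨L, hL⟩ := exists_isBestArrangement G
  have hlen : L.length = Fintype.card V := by
    rw [← List.toFinset_card_of_nodup hL.nodup, ← Finset.card_univ]
    congr 1
    ext a
    simp [hL.mem a]
  obtain ⟨a, b, l, rfl⟩ : ∃ a b l, L = a :: b :: l := by
    match L with
    | [] => simp at hlen; omega
    | [a] => simp at hlen; omega
    | a :: b :: l => exact ⟨a, b, l, rfl⟩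
  rcases List.eq_nil_or_concat l with rfl | ⟨l, z, rfl⟩
  · simp at hlen; omega
  have hab := IsBestArrangement.adj_head hdeg hL
  have hza : G.Adj z a := by
    have : IsBestArrangement G ((a :: b :: l) ++ [z]) := by simpa using hL
    exact IsBestArrangement.adj_head hdeg this.append_comm
  have hch := (hL.isChain hdeg).of_cons
  obtain ⟨p, hp⟩ := exists_walk_support_eq l (by simpa using hch)
  have hnd := hL.nodup
  rw [List.nodup_cons] at hnd
  have hap : a ∉ p.support := by rw [hp]; simpa using hnd.1
  have hnd2 : (b :: (l ++ [z])).Nodup := by simpa using hnd.2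
  have hpp : p.IsPath := by rw [Walk.isPath_def, hp]; exact hnd2
  refine ⟨a, Walk.cons hab (p.concat hza), ?_⟩
  rw [Walk.isHamiltonianCycle_iff_isCycle_and_length_eq, Walk.cons_isCycle_iff]
  refine ⟨⟨hpp.concat hap hza, ?_⟩, ?_⟩
  · rw [Walk.edges_concat, List.concat_eq_append, List.mem_append, List.mem_singleton]
    rintro (h | h)
    · exact hap (p.fst_mem_support_of_mem_edges h)
    · rw [Sym2.eq_swap, Sym2.congr_left] at h
      subst h
      simp at hnd2
  · have h1 := p.length_support
    rw [hp] at h1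
    rw [Walk.length_cons, Walk.length_concat, ← h1, ← hlen]
    simp

/-- A path with an even number of vertices has a perfect matching. -/
theorem exists_involution_of_isChain {V : Type*} [DecidableEq V] {G : SimpleGraph V} :
    ∀ (l : List V), l.IsChain G.Adj → l.Nodup → Even l.length →
      ∃ f : V → V, (∀ a, f (f a) = a) ∧ (∀ a ∈ l, f a ∈ l ∧ G.Adj a (f a)) ∧ ∀ a ∉ l, f a = a
  | [], _, _, _ => ⟨id, by simp⟩
  | [a], _, _, h => by simp at h
  | x :: y :: l, hc, hn, he => by
    rw [List.isChain_cons_cons] at hc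
    have hxy := hc.1
    simp only [List.nodup_cons, List.mem_cons, not_or] at hn
    obtain ⟨f, h1, h2, h3⟩ := exists_involution_of_isChain l hc.2.of_cons hn.2.2 (by
      simpa [Nat.even_add_one] using he)
    have hx := h3 x hn.1.2
    have hy := h3 y hn.2.1
    have hfx : ∀ a, f a = x → a = x := fun a h => by rw [← h1 a, h, hx]
    have hfy : ∀ a, f a = y → a = y := fun a h => by rw [← h1 a, h, hy]
    refine ⟨fun a => if a = x then y else if a = y then x else f a, ?_, ?_, ?_⟩
    · intro a
      beta_reduce
      by_cases ha : a = x
      · simp [ha, hxy.ne']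
      by_cases hb : a = y
      · simp [hb, hxy.ne']
      have hfax : f a ≠ x := fun h => ha (hfx a h)
      have hfay : f a ≠ y := fun h => hb (hfy a h)
      simp [ha, hb, hfax, hfay, h1]
    · intro a ha
      by_cases hax : a = x
      · simp [hax, hxy]
      by_cases hay : a = y
      · simp [hay, hxy.ne', hxy.symm]
      have hal : a ∈ l := by simpa [hax, hay] using ha
      simp [hax, hay, h2 a hal]
    · intro a ha
      simp only [List.mem_cons, not_or] at ha
      simp [ha.1, ha.2.1, h3 a ha.2.2]

/-- In a best arrangement starting at `v`, the other vertices form a path of even order, matched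
along alternate edges. -/
theorem exists_isPairing_of_card_le (hdeg : ∀ v, Fintype.card V ≤ 2 * G.degree v)
    (hodd : Odd (Fintype.card V)) (v : V) :
    ∃ f, IsPairing G f ∧ ∀ a, f a = a ↔ a = v := by
  obtain ⟨L, hL⟩ := exists_isBestArrangement_cons G v
  have hlen : (v :: L).length = Fintype.card V := by
    rw [← List.toFinset_card_of_nodup hL.nodup, ← Finset.card_univ]
    congr 1
    ext a
    simp only [List.mem_toFinset, Finset.mem_univ, iff_true]
    exact hL.mem a
  have heven : Even L.length := by
    rw [← hlen, List.length_cons, Nat.odd_add_one] at hodd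
    simpa using hodd
  obtain ⟨hvL, hnd⟩ := List.nodup_cons.1 hL.nodup
  obtain ⟨f, h1, h2, h3⟩ := exists_involution_of_isChain L (hL.isChain hdeg).of_cons hnd heven
  have hmem : ∀ a, a ≠ v → a ∈ L := fun a ha => (List.mem_cons.1 (hL.mem a)).resolve_left ha
  refine ⟨f, ⟨h1, fun a ha => (h2 a ?_).2⟩, fun a => ⟨fun ha => ?_, fun ha => ?_⟩⟩
  · by_contra h
    exact ha (h3 a h)
  · by_contra h
    exact (h2 a (hmem a h)).2.ne ha.symm
  · rw [ha]
    exact h3 v hvL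

end Dirac

/-! ### Edge-minimality and the main theorem -/

theorem IsPairing.hasPerfectMatching {V : Type*} {F : SimpleGraph V} {f : V → V}
    (hf : IsPairing F f) {v : V} (hv : ∀ a, f a = a ↔ a = v) :
    HasPerfectMatching (deleteVertex F v) := by
  have hfv : ∀ a, a ≠ v → f a ≠ v := fun a ha h => ha (by rw [← hf.invol a, h, (hv v).2 rfl])
  let M : (deleteVertex F v).Subgraph :=
    { verts := Set.univ
      Adj := fun a b => f a = b
      adj_sub := by
        rintro ⟨a, ha⟩ ⟨b, hb⟩ rfl
        exact hf.adj a fun h => ha ((hv a).1 h)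
      edge_vert := fun _ => Set.mem_univ _
      symm := ⟨by
        rintro ⟨a, ha⟩ ⟨b, hb⟩ h
        change f a = b at h
        change f b = a
        rw [← h, hf.invol]⟩ }
  refine ⟨M, fun a _ => ⟨⟨f a, hfv a a.2⟩, rfl, fun b hb => Subtype.ext (Eq.symm (show f a = b from hb))⟩,
    fun a => Set.mem_univ a⟩

/-- Deleting an edge from an edge-minimum counterexample raises the independence number. -/
theorem IsEdgeMinCounterexample.indepNum_lt {V : Type u} [Finite V] {G : SimpleGraph V}
    (hE : IsEdgeMinCounterexample G) {t : ℕ} (hn : Nat.card V + 1 = 2 * t)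
    (ht : G.Colorable t) (hno : ¬ HasCliqueImmersion G t) {e : Sym2 V} (he : e ∈ G.edgeSet) :
    G.indepNum < (G.deleteEdges {e}).indepNum := by
  classical
  by_contra! hle
  have hfin : Fintype V := Fintype.ofFinite V
  have hsub : G.deleteEdges {e} ≤ G := deleteEdges_le _
  have hα : (G.deleteEdges {e}).indepNum ≤ 2 := hle.trans hE.1.1.1
  have hchrom : (G.deleteEdges {e}).chromaticNumber = t := by
    refine le_antisymm (chromaticNumber_le_iff_colorable.2 (ht.mono_left hsub)) ?_
    obtain ⟨k, hk', hk⟩ := exists_chromaticNumber_eq_natCast (G.deleteEdges {e})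
    replace hk := (hk k).2 le_rfl
    rw [hk', Nat.cast_le]
    -- Colour classes still have at most two vertices, so `n = 2t - 1` alone forces `t` colours.
    obtain ⟨f, -, hf⟩ := exists_isPairing_of_colorable (HasNoIndepTriple.of_indepNum_le hα) hk
    rw [Nat.card_eq_fintype_card] at hn
    omega
  have hcex : IsCounterexample (G.deleteEdges {e}) := by
    refine ⟨hα, t, hchrom, fun h => hno ?_⟩
    exact (HasCliqueImmersion.of_immersed h).mono hsub
  have hlt : (G.deleteEdges {e}).edgeSet.ncard < G.edgeSet.ncard := by
    rw [edgeSet_deleteEdges]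
    exact Set.ncard_sdiff_singleton_lt_of_mem he
  exact (hE.2 V (G.deleteEdges {e}) ⟨hcex, hE.1.2⟩).not_gt hlt

theorem mainTheorem6 {V : Type u} [Fintype V] [DecidableEq V] (G : SimpleGraph V)
    [DecidableRel G.Adj] (hG : IsVertexMinCounterexample G) :
    IsChromaticMinCounterexample G ∧
    (∀ v : V, HasPerfectMatching (deleteVertex Gᶜ v)) ∧
    (∀ x y : V, x ≠ y → ¬ G.Adj x y →
      ((G.commonNeighbors x y).ncard : ℚ) ≤ ((Fintype.card V : ℚ) - 1) / 2) ∧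
    ((Fintype.card V : ℚ) + 1) / 4 ≤ (G.cliqueNum : ℚ) ∧
    G.Connected ∧
    ⌈(Fintype.card V : ℚ) / 2⌉₊ ≤ G.minDegree ∧
    (∃ (a : V) (p : G.Walk a a), p.IsHamiltonianCycle) ∧
    (∀ v : V, HasPerfectMatching (deleteVertex G v)) ∧
    (∀ x y : V, G.edist x y ≤ 2) ∧
    8 ≤ G.chromaticNumber ∧
    (IsEdgeMinCounterexample G →
      ∀ e ∈ G.edgeSet, G.indepNum < (G.deleteEdges {e}).indepNum) := by
  have hmin : ∀ S : Set V, S ≠ Set.univ → ¬ IsCounterexample (G.induce S) := by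
    intro S hS h
    have := hG.2 S _ h
    rw [Nat.card_coe_set_eq] at this
    exact this.not_gt (Set.ncard_lt_card hS)
  obtain ⟨hnear, t, ht, hn, hcol, hno⟩ := hG.1.hasNearPairings_or hmin
  have hα : HasNoIndepTriple G := (isCounterexample_iff.1 hG.1).1
  have hnat := hn
  rw [Nat.card_eq_fintype_card] at hn
  have hdeg : ∀ v, t < G.degree v := hnear.lt_degree hα hn hno
  have hnq : (Fintype.card V : ℚ) = 2 * t - 1 := by
    have : ((Fintype.card V + 1 : ℕ) : ℚ) = (2 * t : ℕ) := by rw [hn]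
    push_cast at this
    linarith
  have hcommon : ∀ x y, x ≠ y → ¬ G.Adj x y →
      (G.neighborFinset x ∩ G.neighborFinset y).card + 3 ≤ t := by
    intro x y hxy hadj
    obtain ⟨k, hk, hi⟩ := (hα.induce {w | w ≠ x ∧ w ≠ y}).exists_colorable_hasCliqueImmersion
      (hmin _ fun h => (h ▸ Set.mem_univ x : x ∈ {w | w ≠ x ∧ w ≠ y}).1 rfl)
    -- `G - x - y` has `2t - 3` vertices, so it needs at least `t - 1` colours and has an immersed
    -- `K_{t-1}`.
    obtain ⟨f, -, hf⟩ := exists_isPairing_of_colorable (hα.induce {w | w ≠ x ∧ w ≠ y})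
      ((hk k).2 le_rfl)
    have hcard : Fintype.card {w | w ≠ x ∧ w ≠ y} + 2 = Fintype.card V := by
      have h1 := Finset.card_add_card_compl ({x, y} : Finset V)
      rw [Finset.card_pair hxy] at h1
      rw [Fintype.card_of_subtype ({x, y} : Finset V)ᶜ (fun a => by simp)]
      omega
    have ht1 : t - 1 + 1 = t := by omega
    have := hα.card_inter_add_lt (k := t - 1) (by rwa [ht1]) hxy hadj (hi.le (by omega))
    omega
  -- With `n = 2t - 1`, at most `t - 3` common neighbours bound the degree sum by `3t - 6`, and
  -- degrees at least `t + 1` force five common neighbours.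
  have hsum : ∀ x y, x ≠ y → ¬ G.Adj x y → 0 < (G.neighborFinset x ∩ G.neighborFinset y).card ∧
      G.degree x + G.degree y + 6 ≤ 3 * t := by
    intro x y hxy hadj
    have h1 := hcommon x y hxy hadj
    have h2 := hα.degree_add_degree hxy hadj
    have h3 := hdeg x
    have h4 := hdeg y
    omega
  have hVne : Nonempty V := by
    rw [← Fintype.card_pos_iff]
    rcases Nat.eq_zero_or_pos (Fintype.card V) with h | h
    · omega
    · exact h
  obtain ⟨x, y, hxy, hadj⟩ : ∃ x y, x ≠ y ∧ ¬ G.Adj x y := by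
    obtain ⟨v⟩ := hVne
    obtain ⟨u, hu⟩ := (G.degree_pos_iff_exists_adj v).1 ((Nat.zero_le t).trans_lt (hdeg v))
    obtain ⟨f, hf, hfu⟩ := hnear u
    exact ⟨v, f v, fun h => hu.ne ((hfu v).1 h.symm), hf.not_adj v⟩
  have ht8 : 8 ≤ t := by
    have := (hsum x y hxy hadj).2
    have := hdeg x
    have := hdeg y
    omega
  have hdirac : ∀ v, Fintype.card V ≤ 2 * G.degree v := fun v => by
    have := hdeg v
    omega
  have hdist : ∀ x y : V, G.edist x y ≤ 2 := by
    intro x y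
    rcases eq_or_ne x y with rfl | hxy
    · simp
    by_cases hadj : G.Adj x y
    · rw [edist_eq_one_iff_adj.2 hadj]
      norm_num
    · obtain ⟨c, hc⟩ := Finset.card_pos.1 (hsum x y hxy hadj).1
      simp only [Finset.mem_inter, mem_neighborFinset] at hc
      exact (Walk.edist_le (Walk.cons hc.1 hc.2.symm.toWalk)).trans (by simp)
  refine ⟨⟨hG.1, ?_⟩, ?_, ?_, ?_, ?_, ?_, ?_, ?_, hdist, ?_, ?_⟩
  · intro W _ H hH
    -- A smaller chromatic number would give a counterexample with fewer than `2t - 1 = n` vertices.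
    obtain ⟨W', _, H', t', hH', ht', hle, hc⟩ := hH.exists_card_add_one_eq
    refine le_trans ?_ hle
    have := hG.2 W' H' hH'
    rw [ht, ht', Nat.cast_le]
    omega
  · intro v
    obtain ⟨f, hf, hv⟩ := hnear v
    exact hf.hasPerfectMatching hv
  · intro x y hxy hadj
    have h1 : G.commonNeighbors x y = (G.neighborFinset x ∩ G.neighborFinset y : Finset V) := by
      ext a
      simp [mem_commonNeighbors]
    rw [h1, Set.ncard_coe_finset, hnq]
    have h2 : (((G.neighborFinset x ∩ G.neighborFinset y).card + 3 : ℕ) : ℚ) ≤ t :=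
      Nat.cast_le.2 (hcommon x y hxy hadj)
    push_cast at h2
    linarith
  · have h1 : ∀ v, Gᶜ.degree v ≤ G.cliqueNum := fun v => by
      rw [← card_neighborFinset_eq_degree]
      exact (hα.isClique_neighborFinset_compl v).card_le_cliqueNum
    -- The non-neighbourhoods of `x` and `y` are cliques with at least `t + 2` vertices in total.
    have h2 : t ≤ 2 * G.cliqueNum := by
      have := h1 x
      have := h1 y
      have := degree_compl_add_degree G x
      have := degree_compl_add_degree G y
      have := (hsum x y hxy hadj).2
      omega
    have h3 : (t : ℚ) ≤ ((2 * G.cliqueNum : ℕ) : ℚ) := Nat.cast_le.2 h2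
    push_cast at h3
    rw [hnq]
    linarith
  · exact ⟨fun x y => edist_ne_top_iff_reachable.1 (ne_top_of_le_ne_top (by simp) (hdist x y))⟩
  · refine Nat.ceil_le.2 ?_
    have h1 : t ≤ G.minDegree := G.le_minDegree_of_forall_le_degree _ fun v => (hdeg v).le
    have h2 : (t : ℚ) ≤ G.minDegree := Nat.cast_le.2 h1
    rw [hnq]
    linarith
  · exact exists_isHamiltonianCycle (by omega) hdirac
  · intro v
    obtain ⟨f, hf, hv⟩ := exists_isPairing_of_card_le hdirac ⟨t - 1, by omega⟩ v
    exact hf.hasPerfectMatching hv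
  · rw [ht]
    exact_mod_cast ht8
  · intro hE e he
    exact hE.indepNum_lt hnat ((hcol t).2 le_rfl) hno he
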